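/- Let $\mathbb D=\{z\in\mathbb C:|z-\tfrac23|<1\}$, let $H^\infty(\mathbb D)$ be the Banach space of bounded holomorphic functions on $\mathbb D$ with the uniform norm, let $T(x)=\frac1x-\lfloor\frac1x\rfloor$ for $x\in(0,1]$, $T(0)=0$, and let $\xi(z)=\frac{1}{(\log 2)(1+z)}$. Let $c\colon\{1,2,3,\dots\}\to[0,\infty)$ be bounded, and put $$\mathfrak h(T)=\int_0^1\log|T'(x)|\,\xi(x)\,dx,\qquad \mu=\frac{2}{\mathfrak h(T)}\sum_{n=1}^\infty c(n)\int_{1/(n+1)}^{1/n}\xi(x)\,dx .$$ For $s,\omega\in\mathbb C$ define $$(\mathcal L_{s,\omega}f)(z)=\sum_{n=1}^\infty\frac{e^{\omega c(n)}}{(z+n)^{2s+\mu\omega}}f\Big(\frac1{z+n}\Big),\qquad (\mathcal F_{s,\omega}f)(z)=\sum_{n=2}^\infty\frac{e^{\omega c(n)}}{(z+n)^{2s+\mu\omega}}f\Big(\frac1{z+n}\Big),$$ with the branch of $\log(z+n)$ that is real for $z\in[0,1]$. Then: (i) There is an open set $\mathcal U\subset\{(s,\omega)\in\mathbb C^2:\Re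 s>\frac12\}$ which contains $(s,0)$ for every $s$ with $\Re s>\frac12$, such that for every $(s,\omega)\in\mathcal U$ the two series converge on $\mathbb D$ for all $f\in H^\infty(\mathbb D)$ and define compact linear operators $\mathcal L_{s,\omega}$, $\mathcal F_{s,\omega}$ on $H^\infty(\mathbb D)$. These operators depend holomorphically on $(s,\omega)\in\mathcal U$ (with respect to the operator norm). (ii) For every $f\in L^1([0,1])$ the series defining $(\mathcal L_{1,0}f)(x)$ converges for almost every $x\in[0,1]$; $\mathcal L_{1,0}$ is a bounded operator on $L^1([0,1])$, and $\int_0^1\mathcal L_{1,0}f\,dx=\int_0^1f\,dx$ for all $f\in L^1([0,1])$. If $f,g\colon[0,1]\to\mathbb C$ are such that $f$ and $f\cdot(g\circ T)$ belong to $L^1([0,1])$, then $\mathcal L_{1,0}(f\cdot(g\circ T))=g\cdot\mathcal L_{1,0}f$ almost everywhere on $[0,1]$. There is a constant $C>1$ such that for all $f\in L^1([0,1])$ one has $f\circ T\in L^1([0,1])$ and $\|f\circ T\|_{L^1}\le C\|f\|_{L^1}$. (iii) There is an open set $\mathcal V\subset\mathcal U$ containing $(1,0)$, and there are holomorphic maps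 $(s,\omega)\mapsto\lambda(s,\omega)\in\mathbb C$ and $(s,\omega)\mapsto\mathcal P_{s,\omega},\mathcal N_{s,\omega}$ from $\mathcal V$ to $\mathbb C$ and to the bounded operators on $H^\infty(\mathbb D)$ respectively, such that for all $(s,\omega)\in\mathcal V$: $\mathcal L_{s,\omega}=\lambda(s,\omega)\mathcal P_{s,\omega}+\mathcal N_{s,\omega}$; $\mathcal P_{s,\omega}\mathcal N_{s,\omega}=\mathcal N_{s,\omega}\mathcal P_{s,\omega}=0$; $\mathcal P_{s,\omega}$ is a projection whose range is one-dimensional and is the eigenspace of $\mathcal L_{s,\omega}$ for the eigenvalue $\lambda(s,\omega)$; and the spectral radius satisfies $\rho(\mathcal N_{s,\omega})<1$ and $\rho(\mathcal N_{s,\omega})<|\lambda(s,\omega)|$. Moreover $\lambda(1,0)=1$ and $\mathcal P_{1,0}f=\big(\int_0^1f(x)\,dx\big)\xi$ for all $f\in H^\infty(\mathbb D)$. -/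

import Mathlib

open MeasureTheory Filter Topology
open scoped BoundedContinuousFunction

noncomputable section

namespace GaussEuclid

/-- The Gauss map `T x = 1/x - ⌊1/x⌋` (with `T 0 = 0`). -/
def gaussMap (x : ℝ) : ℝ := 1 / x - (⌊1 / x⌋ : ℝ)

/-- The Gauss density `ξ x = 1 / (log 2 * (1 + x))`. -/
def gaussDensity (x : ℝ) : ℝ := 1 / (Real.log 2 * (1 + x))

/-- The holomorphic extension of the Gauss density. -/
def xi (z : ℂ) : ℂ := 1 / ((Real.log 2 : ℂ) * (1 + z))

/-- The entropy constant `h(T) = ∫₀¹ log |T' x| ξ x dx`. -/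
def entropyConst : ℝ := ∫ x in (0 : ℝ)..1, Real.log |deriv gaussMap x| * gaussDensity x

/-- The mean `μ = (2 / h(T)) ∑_{n ≥ 1} c n ∫_{1/(n+1)}^{1/n} ξ x dx` of the cost function `c`. -/
def mean (c : ℕ → ℝ) : ℝ :=
  2 / entropyConst *
    ∑' n : ℕ, c (n + 1) * ∫ x in (1 / ((n : ℝ) + 2))..(1 / ((n : ℝ) + 1)), gaussDensity x

/-- The open disc of centre `2/3` and radius `1`. -/
def disc : Set ℂ := Metric.ball (2 / 3) 1

/-- The function on `ℂ` which equals `f` on the disc and `0` off the disc. -/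
def zeroExt (f : disc → ℂ) : ℂ → ℂ := Function.extend Subtype.val f 0

theorem zeroExt_apply (f : disc → ℂ) (z : disc) : zeroExt f z = f z :=
  Subtype.val_injective.extend_apply f 0 z

/-- The space of bounded holomorphic functions on the disc, with the uniform norm (which is
inherited from the space of bounded continuous functions). -/
def Hinf : Submodule ℂ (disc →ᵇ ℂ) where
  carrier := {f | DifferentiableOn ℂ (zeroExt f) disc}
  zero_mem' := by
    refine (differentiableOn_const (0 : ℂ)).congr fun z hz => ?_
    exact zeroExt_apply _ ⟨z, hz⟩
  add_mem' := by
    intro f g hf hg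
    refine (DifferentiableOn.add hf hg).congr fun z hz => ?_
    simp only [Pi.add_apply]
    rw [zeroExt_apply _ ⟨z, hz⟩, zeroExt_apply _ ⟨z, hz⟩, zeroExt_apply _ ⟨z, hz⟩]
    rfl
  smul_mem' := by
    intro a f hf
    refine (DifferentiableOn.const_smul hf a).congr fun z hz => ?_
    simp only [Pi.smul_apply]
    rw [zeroExt_apply _ ⟨z, hz⟩, zeroExt_apply _ ⟨z, hz⟩]
    rfl

/-- The value of an element of `Hinf` at a point of the disc (and `0` off the disc). -/
def hval (f : Hinf) : ℂ → ℂ := zeroExt f.1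

theorem Hinf.ext_hval {f g : Hinf} (h : ∀ z ∈ disc, hval f z = hval g z) : f = g := by
  apply Subtype.ext
  ext z
  have := h z z.2
  rwa [hval, hval, zeroExt_apply, zeroExt_apply] at this

/-- The weight `e^{ω c(n)} / (z + n)^{2s + μω}`. The principal branch is the right one, because
`z + n` has positive real part for `z` in the disc and `n ≥ 1`. -/
def weight (c : ℕ → ℝ) (s ω : ℂ) (n : ℕ) (z : ℂ) : ℂ :=
  Complex.exp (ω * (c n : ℂ)) / (z + (n : ℂ)) ^ (2 * s + (mean c : ℂ) * ω)

/-- `A` is the operator on `Hinf` with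
`(A f) z = ∑_{n ≥ m} e^{ω c(n)} / (z + n)^{2s + μω} * f (1 / (z + n))`,
the series converging at every point of the disc. -/
def IsTransferOp (c : ℕ → ℝ) (m : ℕ) (s ω : ℂ) (A : Hinf →L[ℂ] Hinf) : Prop :=
  ∀ (f : Hinf), ∀ z ∈ disc,
    HasSum (fun n : ℕ => weight c s ω (n + m) z * hval f (1 / (z + ((n + m : ℕ) : ℂ))))
      (hval (A f) z)

theorem IsTransferOp.unique {c : ℕ → ℝ} {m : ℕ} {s ω : ℂ} {A B : Hinf →L[ℂ] Hinf}
    (hA : IsTransferOp c m s ω A) (hB : IsTransferOp c m s ω B) : A = B := by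
  ext1 f
  exact Hinf.ext_hval fun z hz => (hA f z hz).unique (hB f z hz)

open Classical in
/-- The unique bounded operator on `Hinf` given by the series over `n ≥ m`, where there is one
(and `0` otherwise). -/
def transferOp (c : ℕ → ℝ) (m : ℕ) (s ω : ℂ) : Hinf →L[ℂ] Hinf :=
  if h : ∃ A, IsTransferOp c m s ω A then h.choose else 0

/-- The weighted Gauss-Kuzmin-Wirsing operator `𝓛_{s,ω}` (sum over `n ≥ 1`), as a function of
`p = (s, ω)`. -/
def opL (c : ℕ → ℝ) (p : ℂ × ℂ) : Hinf →L[ℂ] Hinf := transferOp c 1 p.1 p.2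

/-- The operator `𝓕_{s,ω}` (sum over `n ≥ 2`), as a function of `p = (s, ω)`. -/
def opF (c : ℕ → ℝ) (p : ℂ × ℂ) : Hinf →L[ℂ] Hinf := transferOp c 2 p.1 p.2

/-- Lebesgue measure on `[0,1]`. -/
def leb01 : Measure ℝ := volume.restrict (Set.Icc 0 1)

end GaussEuclid

end

open GaussEuclid

/-!
In logarithmic coordinates the exponential weight is `exp (-w log (z + n))` with `w = 2s + μω`, so
each branch of the transfer operator depends holomorphically on `(s, ω)`; it is compact because
`z ↦ 1 / (z + n)` maps the disc into a smaller closed disc, and the series over `n` converges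
normally when `Re w > 1`.

At `(1, 0)` the operator `L` preserves the integral and fixes `ξ`. If `L f = k f` with `|k| ≥ 1`,
then `(1 + z) f` is an eigenfunction of an averaging operator, so it is constant along the sequence
`1 / n → 0` by the maximum principle, and therefore constant. Thus `ξ` spans the eigenspaces for
`|k| ≥ 1`, and by compactness `L - (∫ ·) ξ` has spectral radius less than `1`.

Near `(1, 0)` write `L p = A p + (∫ ·) ξ`. A number `λ` in the resolvent set of `A p` is an
eigenvalue of `L p` as soon as `∫ (λ - A p)⁻¹ ξ = 1`, and the implicit function theorem solves this
equation for `λ = λ(p)` analytically. The eigenprojection is then explicit, and the bounds on the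
spectral radius of the complementary part persist by upper semicontinuity.

On `L¹` the change of variables `y = 1 / (x + n)` turns the terms of the series into the
restrictions of `f` to the disjoint intervals `(1 / (n + 1), 1 / n]`, whose norms sum to the norm of
`f`.
-/

namespace GaussEuclid

noncomputable section

/-! ### Series of operators -/

section ExpMap

variable {A : Type*} [NormedRing A] [NormedAlgebra ℂ A] [CompleteSpace A]

theorem map_exp_of_map_pow (φ : A →L[ℂ] ℂ) {x : A} {t a : ℂ} (h : ∀ n : ℕ, φ (x ^ n) = t ^ n * a) :
    φ (NormedSpace.exp x) = Complex.exp t * a := by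
  have hφ := (NormedSpace.exp_series_hasSum_exp' (𝕂 := ℂ) x).mapL φ
  have ht := (NormedSpace.exp_series_hasSum_exp' (𝕂 := ℂ) t).mul_right a
  rw [← Complex.exp_eq_exp_ℂ] at ht
  refine hφ.unique (ht.congr_fun fun n => ?_)
  rw [map_smul, h, smul_eq_mul, smul_eq_mul, mul_assoc]

end ExpMap

section ExpComp

variable {E : Type*} [NormedAddCommGroup E] [NormedSpace ℂ E]

/-- The operator `exp (w • A) ∘ B`. When `A` is the multiplication by a function `h`, this is the
weighted operator with the factor `exp (w * h)`, exhibited as an entire function of `w`. -/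
def expComp (A B : E →L[ℂ] E) (w : ℂ) : E →L[ℂ] E := (NormedSpace.exp (w • A)).comp B

theorem isCompactOperator_expComp (A : E →L[ℂ] E) {B : E →L[ℂ] E} (hB : IsCompactOperator B)
    (w : ℂ) : IsCompactOperator (expComp A B w) :=
  hB.clm_comp _

variable [CompleteSpace E]

theorem map_expComp_apply (φ : E →L[ℂ] ℂ) {A : E →L[ℂ] E} {t : ℂ} (h : ∀ f, φ (A f) = t * φ f)
    (B : E →L[ℂ] E) (w : ℂ) (f : E) :
    φ (expComp A B w f) = Complex.exp (w * t) * φ (B f) := by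
  refine map_exp_of_map_pow (φ.comp (ContinuousLinearMap.apply ℂ E (B f))) fun n => ?_
  change φ (((w • A) ^ n) (B f)) = (w * t) ^ n * φ (B f)
  induction n with
  | zero => simp
  | succ n ih =>
    rw [pow_succ', mul_apply_eq_comp, smul_apply, map_smul, h, ih, smul_eq_mul, pow_succ',
      mul_assoc, mul_assoc]

theorem differentiable_expComp (A B : E →L[ℂ] E) : Differentiable ℂ (expComp A B) := by
  refine Differentiable.clm_comp (fun w => ?_) (differentiable_const B)
  exact (NormedSpace.exp_analytic (𝕂 := ℂ) (w • A)).differentiableAt.comp w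
    (differentiableAt_id.smul_const A)

end ExpComp

section SeriesOp

variable {F : Type*} [NormedAddCommGroup F] [NormedSpace ℂ F]

/-- The map `a ↦ ∑ a n • v n` on bounded sequences, for an absolutely summable family `v`. Since
it is linear in `a`, a series with coefficients depending holomorphically on several variables is
holomorphic as soon as the sequence of coefficients is holomorphic in the supremum norm. -/
def seriesOp (v : ℕ → F) : (ℕ →ᵇ ℂ) →L[ℂ] F :=
  ∑' n, (BoundedContinuousFunction.evalCLM ℂ n).smulRight (v n)

theorem norm_evalCLM_smulRight_le (n : ℕ) (v : F) :
    ‖((BoundedContinuousFunction.evalCLM ℂ n : (ℕ →ᵇ ℂ) →L[ℂ] ℂ)).smulRight v‖ ≤ ‖v‖ := by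
  refine ContinuousLinearMap.opNorm_le_bound _ (norm_nonneg v) fun a => ?_
  rw [ContinuousLinearMap.smulRight_apply, norm_smul, mul_comm]
  exact mul_le_mul_of_nonneg_left (a.norm_coe_le_norm n) (norm_nonneg v)

theorem exp_smul_apply (a : ℕ →ᵇ ℂ) (ω : ℂ) (n : ℕ) :
    NormedSpace.exp (ω • a) n = Complex.exp (ω * a n) := by
  simpa using map_exp_of_map_pow (BoundedContinuousFunction.evalCLM ℂ n) (x := ω • a)
    (t := ω * a n) (a := 1) fun k => by simp

variable [CompleteSpace F]

theorem hasSum_seriesOp {v : ℕ → F} (hv : Summable fun n => ‖v n‖) (a : ℕ →ᵇ ℂ) :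
    HasSum (fun n => a n • v n) (seriesOp v a) :=
  (Summable.of_norm_bounded hv fun n => norm_evalCLM_smulRight_le n (v n)).hasSum.mapL
    (ContinuousLinearMap.apply ℂ F a)

theorem hasSum_seriesOp_exp {v : ℕ → F} {u : ℕ → ℝ} (hu : Summable u) (hvu : ∀ n, ‖v n‖ ≤ u n)
    (a : ℕ →ᵇ ℂ) (ω : ℂ) :
    HasSum (fun n => Complex.exp (ω * a n) • v n) (seriesOp v (NormedSpace.exp (ω • a))) := by
  have hv : Summable fun n => ‖v n‖ := hu.of_nonneg_of_le (fun _ => norm_nonneg _) hvu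
  simpa only [exp_smul_apply] using hasSum_seriesOp hv (NormedSpace.exp (ω • a))

theorem analyticAt_seriesOp {O : Set ℂ} (hO : IsOpen O) {v : ℕ → ℂ → F}
    (hv : ∀ n, DifferentiableOn ℂ (v n) O) {u : ℕ → ℝ} (hu : Summable u)
    (hvu : ∀ n, ∀ w ∈ O, ‖v n w‖ ≤ u n) {w : ℂ} (hw : w ∈ O) :
    AnalyticAt ℂ (fun w => seriesOp fun n => v n w) w := by
  refine DifferentiableOn.analyticAt (s := O) ?_ (hO.mem_nhds hw)
  refine Complex.differentiableOn_tsum_of_summable_norm hu (fun n => ?_) hO fun n w hw =>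
    (norm_evalCLM_smulRight_le n _).trans (hvu n w hw)
  exact (ContinuousLinearMap.smulRightL ℂ (ℕ →ᵇ ℂ) F
    (BoundedContinuousFunction.evalCLM ℂ n)).differentiable.comp_differentiableOn (hv n)

theorem analyticAt_seriesOp_exp {O : Set ℂ} (hO : IsOpen O) {v : ℕ → ℂ → F}
    (hv : ∀ n, DifferentiableOn ℂ (v n) O) {u : ℕ → ℝ} (hu : Summable u)
    (hvu : ∀ n, ∀ w ∈ O, ‖v n w‖ ≤ u n) (a : ℕ →ᵇ ℂ) {G : Type*} [NormedAddCommGroup G]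
    [NormedSpace ℂ G] {w ω : G → ℂ} {p : G} (hw : AnalyticAt ℂ w p) (hω : AnalyticAt ℂ ω p)
    (hwO : w p ∈ O) :
    AnalyticAt ℂ (fun p => seriesOp (fun n => v n (w p)) (NormedSpace.exp (ω p • a))) p := by
  have hseries : AnalyticAt ℂ (fun p => seriesOp fun n => v n (w p)) p :=
    (analyticAt_seriesOp hO hv hu hvu hwO).fun_comp hw
  have hexp : AnalyticAt ℂ (fun p => NormedSpace.exp (ω p • a)) p :=
    AnalyticAt.fun_comp (g := NormedSpace.exp) (f := fun p => ω p • a)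
      (NormedSpace.exp_analytic (𝕂 := ℂ) _) (hω.smul analyticAt_const)
  exact AnalyticAt.comp₂ (ContinuousLinearMap.analyticAt_bilinear
    (ContinuousLinearMap.id ℂ ((ℕ →ᵇ ℂ) →L[ℂ] F)) _) hseries hexp

end SeriesOp

section CompactOperators

variable {𝕜 E F : Type*} [NontriviallyNormedField 𝕜] [NormedAddCommGroup E] [NormedSpace 𝕜 E]
  [NormedAddCommGroup F] [NormedSpace 𝕜 F]

theorem isCompactOperator_of_hasSum {ι : Type*} [CompleteSpace F] {T : ι → E →L[𝕜] F}
    {S : E →L[𝕜] F} (hT : ∀ i, IsCompactOperator (T i)) (hS : HasSum T S) : IsCompactOperator S :=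
  isCompactOperator_of_tendsto hS <| Eventually.of_forall fun _ =>
    (compactOperator (RingHom.id 𝕜) E F).sum_mem fun i _ => hT i

theorem isCompactOperator_smulRight [LocallyCompactSpace 𝕜] (φ : E →L[𝕜] 𝕜) (e : F) :
    IsCompactOperator (φ.smulRight e) :=
  (isCompactOperator_of_locallyCompactSpace_dom φ).clm_comp
    (ContinuousLinearMap.toSpanSingleton 𝕜 e)

theorem summable_smulRight {ι : Type*} [CompleteSpace F] {φ : ι → E →L[𝕜] 𝕜} {e : ι → F}
    (h : Summable fun i => ‖φ i‖ * ‖e i‖) : Summable fun i => (φ i).smulRight (e i) :=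
  Summable.of_norm_bounded h fun i => (ContinuousLinearMap.norm_smulRight_apply (φ i) (e i)).le

theorem isCompactOperator_of_nuclear {ι : Type*} [LocallyCompactSpace 𝕜] [CompleteSpace F]
    {φ : ι → E →L[𝕜] 𝕜} {e : ι → F} (h : Summable fun i => ‖φ i‖ * ‖e i‖) :
    IsCompactOperator (∑' i, (φ i).smulRight (e i) : E →L[𝕜] F) :=
  isCompactOperator_of_hasSum (fun i => isCompactOperator_smulRight (φ i) (e i))
    (summable_smulRight h).hasSum

end CompactOperators

section OperatorSeries

variable {E F : Type*} [NormedAddCommGroup E] [NormedSpace ℂ E] [NormedAddCommGroup F]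
  [NormedSpace ℂ F] [CompleteSpace F] {v : ℕ → E →L[ℂ] F} {u : ℕ → ℝ}

theorem isCompactOperator_seriesOp_exp (hu : Summable u) (hvu : ∀ n, ‖v n‖ ≤ u n)
    (hv : ∀ n, IsCompactOperator (v n)) (a : ℕ →ᵇ ℂ) (ω : ℂ) :
    IsCompactOperator (seriesOp v (NormedSpace.exp (ω • a))) :=
  isCompactOperator_of_hasSum
    (fun n => (compactOperator (RingHom.id ℂ) E F).smul_mem (Complex.exp (ω * a n)) (hv n))
    (hasSum_seriesOp_exp hu hvu a ω)

theorem hasSum_map_seriesOp_exp_apply (hu : Summable u) (hvu : ∀ n, ‖v n‖ ≤ u n) (a : ℕ →ᵇ ℂ)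
    (ω : ℂ) (φ : F →L[ℂ] ℂ) (f : E) :
    HasSum (fun n => Complex.exp (ω * a n) * φ (v n f))
      (φ (seriesOp v (NormedSpace.exp (ω • a)) f)) := by
  refine ((hasSum_seriesOp_exp hu hvu a ω).mapL
    (φ.comp (ContinuousLinearMap.apply ℂ F f))).congr_fun fun n => ?_
  exact (map_smul φ _ _).symm

end OperatorSeries

/-! ### Perturbation of a simple eigenvalue -/

section RankOneSplitting

variable {𝕜 E : Type*} [NontriviallyNormedField 𝕜] [NormedAddCommGroup E] [NormedSpace 𝕜 E]

/-- The splitting `T = lam P + N`, `P N = N P = 0`, by a projection `P` of rank one onto the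
eigenspace of `T` for the eigenvalue `lam`. -/
def IsRankOneSplitting (T : E →L[𝕜] E) (lam : 𝕜) (P N : E →L[𝕜] E) : Prop :=
  T = lam • P + N ∧ P.comp N = 0 ∧ N.comp P = 0 ∧ P.comp P = P ∧
    Module.finrank 𝕜 (LinearMap.range (P : E →ₗ[𝕜] E)) = 1 ∧
    LinearMap.range (P : E →ₗ[𝕜] E) = Module.End.eigenspace (T : E →ₗ[𝕜] E) lam

/-- The projection onto the line through `h` along the kernel of `m`, where `m h ≠ 0`. -/
def lineProj (m : E →L[𝕜] 𝕜) (h : E) : E →L[𝕜] E := (m h)⁻¹ • m.smulRight h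

theorem lineProj_apply (m : E →L[𝕜] 𝕜) (h f : E) : lineProj m h f = ((m h)⁻¹ * m f) • h := by
  simp only [lineProj, smul_apply, ContinuousLinearMap.smulRight_apply, smul_smul]

theorem lineProj_self {m : E →L[𝕜] 𝕜} {h : E} (hm : m h ≠ 0) : lineProj m h h = h := by
  rw [lineProj_apply, inv_mul_cancel₀ hm, one_smul]

theorem lineProj_comp_self {m : E →L[𝕜] 𝕜} {h : E} (hm : m h ≠ 0) :
    (lineProj m h).comp (lineProj m h) = lineProj m h := by
  ext f
  rw [ContinuousLinearMap.comp_apply, lineProj_apply m h f, map_smul, lineProj_self hm]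

theorem range_lineProj {m : E →L[𝕜] 𝕜} {h : E} (hm : m h ≠ 0) :
    LinearMap.range (lineProj m h : E →ₗ[𝕜] E) = 𝕜 ∙ h := by
  ext f
  rw [Submodule.mem_span_singleton, LinearMap.mem_range]
  constructor
  · rintro ⟨g, rfl⟩
    exact ⟨_, (lineProj_apply m h g).symm⟩
  · rintro ⟨a, rfl⟩
    exact ⟨a • h, by rw [ContinuousLinearMap.coe_coe, map_smul, lineProj_self hm]⟩

theorem isRankOneSplitting_lineProj {T : E →L[𝕜] E} {lam : 𝕜} {m : E →L[𝕜] 𝕜} {h : E}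
    (hmh : m h ≠ 0) (hh : T h = lam • h) (hm : ∀ f, m (T f) = lam * m f)
    (hspan : ∀ f, T f = lam • f → f ∈ 𝕜 ∙ h) :
    IsRankOneSplitting T lam (lineProj m h) (T - lam • lineProj m h) := by
  have hTP : T.comp (lineProj m h) = lam • lineProj m h := by
    ext f
    rw [ContinuousLinearMap.comp_apply, smul_apply, lineProj_apply, map_smul, hh, smul_comm]
  have hPT : (lineProj m h).comp T = lam • lineProj m h := by
    ext f
    rw [ContinuousLinearMap.comp_apply, smul_apply, lineProj_apply, lineProj_apply, hm, smul_smul,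
      mul_left_comm]
  have hh0 : h ≠ 0 := fun h0 => hmh (by rw [h0, map_zero])
  refine ⟨(add_sub_cancel _ _).symm, ?_, ?_, lineProj_comp_self hmh, ?_, ?_⟩
  · rw [ContinuousLinearMap.comp_sub, hPT, ContinuousLinearMap.comp_smul, lineProj_comp_self hmh,
      sub_self]
  · rw [ContinuousLinearMap.sub_comp, hTP, ContinuousLinearMap.smul_comp, lineProj_comp_self hmh,
      sub_self]
  · rw [range_lineProj hmh, finrank_span_singleton hh0]
  · rw [range_lineProj hmh]
    refine le_antisymm ?_ fun f hf => hspan f (Module.End.mem_eigenspace_iff.1 hf)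
    exact (Submodule.span_singleton_le_iff_mem _ _).2 (Module.End.mem_eigenspace_iff.2 hh)

theorem apply_resolvent {A : E →L[𝕜] E} {z : 𝕜} (hz : z ∈ resolventSet 𝕜 A) (f : E) :
    A (resolvent A z f) = z • resolvent A z f - f := by
  have h := DFunLike.congr_fun (Ring.mul_inverse_cancel _ hz) f
  rw [Algebra.algebraMap_eq_smul_one] at h
  simp only [mul_apply_eq_comp, sub_apply, smul_apply, one_apply_eq_self] at h
  rw [resolvent, Algebra.algebraMap_eq_smul_one, eq_sub_iff_add_eq, ← eq_sub_iff_add_eq', h]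

theorem resolvent_apply {A : E →L[𝕜] E} {z : 𝕜} (hz : z ∈ resolventSet 𝕜 A) (f : E) :
    resolvent A z (A f) = z • resolvent A z f - f := by
  have h := DFunLike.congr_fun (Ring.inverse_mul_cancel _ hz) f
  rw [Algebra.algebraMap_eq_smul_one] at h
  simp only [mul_apply_eq_comp, sub_apply, smul_apply, one_apply_eq_self, map_sub, map_smul] at h
  rw [resolvent, Algebra.algebraMap_eq_smul_one, eq_sub_iff_add_eq, ← eq_sub_iff_add_eq', h]

variable {T : E →L[𝕜] E} {ξ : E} {l : E →L[𝕜] 𝕜} {lam : 𝕜}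

/-- A rank one perturbation `A + ξ ⊗ l` has the eigenvalue `lam` as soon as `l (R ξ) = 1` for
the resolvent `R` of `A` at `lam`; the eigenvectors are `R ξ` on the right and `l ∘ R` on the
left. -/
theorem isRankOneSplitting_of_resolvent (hlam : lam ∈ resolventSet 𝕜 (T - l.smulRight ξ))
    (h1 : l (resolvent (T - l.smulRight ξ) lam ξ) = 1)
    (h2 : l (resolvent (T - l.smulRight ξ) lam (resolvent (T - l.smulRight ξ) lam ξ)) ≠ 0) :
    let R := resolvent (T - l.smulRight ξ) lam
    IsRankOneSplitting T lam (lineProj (l.comp R) (R ξ))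
      (T - lam • lineProj (l.comp R) (R ξ)) := by
  intro R
  have hT : ∀ f, T f = (T - l.smulRight ξ) f + l f • ξ := fun f => by
    rw [sub_apply, ContinuousLinearMap.smulRight_apply, sub_add_cancel]
  have hRT : ∀ f, R (T f) = lam • R f - f + l f • R ξ := fun f => by
    rw [hT, map_add, resolvent_apply hlam, map_smul]
  refine isRankOneSplitting_lineProj h2 ?_ (fun f => ?_) fun f hf => ?_
  · rw [hT, apply_resolvent hlam, h1, one_smul, sub_add_cancel]
  · rw [ContinuousLinearMap.comp_apply, hRT, map_add, map_sub, map_smul, map_smul, h1]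
    simp only [smul_eq_mul, mul_one, sub_add_cancel, ContinuousLinearMap.comp_apply]
  · have h := hRT f
    rw [hf, map_smul, eq_comm, sub_add, sub_eq_self, sub_eq_zero] at h
    exact Submodule.mem_span_singleton.2 ⟨l f, h.symm⟩

end RankOneSplitting

section Analytic

variable {G A : Type*} [NormedAddCommGroup G] [NormedSpace ℂ G] [NormedRing A]
  [NormedAlgebra ℂ A] [CompleteSpace A]

theorem analyticAt_resolvent {a : G → A} {z : G → ℂ} {p : G} (ha : AnalyticAt ℂ a p)
    (hz : AnalyticAt ℂ z p) (hp : z p ∈ resolventSet ℂ (a p)) :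
    AnalyticAt ℂ (fun q => resolvent (a q) (z q)) p := by
  obtain ⟨u, hu⟩ := hp
  have hinv : AnalyticAt ℂ Ring.inverse (algebraMap ℂ A (z p) - a p) :=
    hu ▸ analyticAt_inverse u
  have halg : AnalyticAt ℂ (fun q => algebraMap ℂ A (z q) - a q) p :=
    (((algebraMapCLM ℂ A).analyticAt _).fun_comp hz).sub ha
  exact hinv.fun_comp (f := fun q => algebraMap ℂ A (z q) - a q) halg

theorem eventually_mem_resolventSet {X : Type*} [TopologicalSpace X] {a : X → A} {z : X → ℂ}
    {p : X} (ha : ContinuousAt a p) (hz : ContinuousAt z p) (hp : z p ∈ resolventSet ℂ (a p)) :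
    ∀ᶠ q in 𝓝 p, z q ∈ resolventSet ℂ (a q) :=
  (((algebraMapCLM ℂ A).continuous.continuousAt.comp hz).sub ha).eventually
    (Units.isOpen.mem_nhds hp)

theorem eventually_spectralRadius_lt {a : A} {r : ENNReal} (hr : spectralRadius ℂ a < r) :
    ∀ᶠ b in 𝓝 a, spectralRadius ℂ b < r := by
  obtain ⟨ρ, haρ, hρr⟩ := ENNReal.lt_iff_exists_nnreal_btwn.1 hr
  have hball : Metric.ball (0 : ℂ) ρ ∈ nhdsSet (spectrum ℂ a) := by
    refine Metric.isOpen_ball.mem_nhdsSet.2 fun z hz => mem_ball_zero_iff.2 ?_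
    have hzρ : (‖z‖₊ : ENNReal) < ρ := (le_iSup₂ (α := ENNReal) z hz).trans_lt haρ
    exact ENNReal.coe_lt_coe.1 hzρ
  filter_upwards [upperHemicontinuous_spectrum ℂ A a _ hball] with b hb
  refine lt_of_le_of_lt (iSup₂_le fun z hz => ?_) hρr
  exact ENNReal.coe_le_coe.2 (mem_ball_zero_iff.1 (subset_of_mem_nhdsSet hb hz)).le

end Analytic

theorem exists_analyticAt_implicit {𝕜 G : Type*} [RCLike 𝕜] [NormedAddCommGroup G]
    [NormedSpace 𝕜 G] [CompleteSpace G] {F : G × 𝕜 → 𝕜} {p₀ : G} {z₀ d : 𝕜}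
    (hF : AnalyticAt 𝕜 F (p₀, z₀)) (hd : HasDerivAt (fun z => F (p₀, z)) d z₀) (hd0 : d ≠ 0) :
    ∃ φ : G → 𝕜, AnalyticAt 𝕜 φ p₀ ∧ φ p₀ = z₀ ∧ ∀ᶠ p in 𝓝 p₀, F (p, φ p) = F (p₀, z₀) := by
  have hpartial : (fderiv 𝕜 F (p₀, z₀)).comp (ContinuousLinearMap.inr 𝕜 G 𝕜) =
      ContinuousLinearMap.toSpanSingleton 𝕜 d :=
    (hF.differentiableAt.hasFDerivAt.comp z₀ (hasFDerivAt_prodMk_right p₀ z₀)).unique hd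
  have hinvert : ((fderiv 𝕜 F (p₀, z₀)).comp (ContinuousLinearMap.inr 𝕜 G 𝕜)).IsInvertible :=
    ⟨ContinuousLinearEquiv.unitsEquivAut 𝕜 (Units.mk0 d hd0), by rw [hpartial]; ext; simp⟩
  have hcd : ContDiffAt 𝕜 ⊤ F (p₀, z₀) := hF.contDiffAt
  exact ⟨hcd.implicitFunction (by simp) hinvert,
    (hcd.contDiffAt_implicitFunction (by simp) hinvert).analyticAt,
    hcd.implicitFunction_apply_self (by simp) hinvert,
    hcd.eventually_apply_implicitFunction (by simp) hinvert⟩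

section SimpleEigenvalue

variable {G E : Type*} [NormedAddCommGroup G] [NormedSpace ℂ G] [NormedAddCommGroup E]
  [NormedSpace ℂ E]

theorem analyticAt_lineProj {m : G → E →L[ℂ] ℂ} {h : G → E} {p : G} (hm : AnalyticAt ℂ m p)
    (hh : AnalyticAt ℂ h p) (hmh : m p (h p) ≠ 0) :
    AnalyticAt ℂ (fun q => lineProj (m q) (h q)) p := by
  have happly : AnalyticAt ℂ (fun q => m q (h q)) p :=
    AnalyticAt.comp₂ (ContinuousLinearMap.analyticAt_bilinear (ContinuousLinearMap.id ℂ _) _) hm hh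
  exact (happly.inv hmh).smul (AnalyticAt.comp₂
    (ContinuousLinearMap.analyticAt_bilinear (ContinuousLinearMap.smulRightL ℂ E E) _) hm hh)

/-- The eigenvalue near `lam₀` is found by solving `l (R ξ) = 1` for the resolvent `R` of
`T p - ξ ⊗ l`; at `p₀` this function of `lam` has the derivative `-l (R (R ξ)) = -1`. -/
theorem exists_analyticAt_isRankOneSplitting [CompleteSpace G] [CompleteSpace E]
    {T : G → E →L[ℂ] E} {p₀ : G}
    (hT : AnalyticAt ℂ T p₀) {ξ : E} {l : E →L[ℂ] ℂ} {lam₀ : ℂ} (hlξ : l ξ = 1)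
    (hξ : T p₀ ξ = lam₀ • ξ) (hl : ∀ f, l (T p₀ f) = lam₀ * l f)
    (hlam₀ : lam₀ ∈ resolventSet ℂ (T p₀ - l.smulRight ξ)) :
    ∃ (lam : G → ℂ) (P : G → E →L[ℂ] E),
      AnalyticAt ℂ lam p₀ ∧ AnalyticAt ℂ P p₀ ∧ lam p₀ = lam₀ ∧ P p₀ = l.smulRight ξ ∧
      ∀ᶠ p in 𝓝 p₀, IsRankOneSplitting (T p) (lam p) (P p) (T p - lam p • P p) := by
  set A : G → E →L[ℂ] E := fun p => T p - l.smulRight ξ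
  have hAan : AnalyticAt ℂ A p₀ := hT.sub analyticAt_const
  have hRξ : resolvent (A p₀) lam₀ ξ = ξ := by
    have h := resolvent_apply hlam₀ ξ
    rw [sub_apply, hξ, ContinuousLinearMap.smulRight_apply, hlξ, one_smul, map_sub, map_smul] at h
    exact sub_right_injective h
  have hlR : ∀ f, l (resolvent (A p₀) lam₀ f) = l f := fun f => by
    have h := congrArg l (apply_resolvent hlam₀ f)
    simpa [hl, hlξ] using h
  have hfun : AnalyticAt ℂ (fun q : G × ℂ => l (resolvent (A q.1) q.2 ξ)) (p₀, lam₀) :=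
    ((l.comp (ContinuousLinearMap.apply ℂ E ξ)).analyticAt _).fun_comp
      (analyticAt_resolvent (hAan.fun_comp analyticAt_fst) analyticAt_snd hlam₀)
  have hderiv : HasDerivAt (fun z => l (resolvent (A p₀) z ξ)) (-1) lam₀ := by
    have h := (l.comp (ContinuousLinearMap.apply ℂ E ξ)).hasFDerivAt.comp_hasDerivAt lam₀
      (spectrum.hasDerivAt_resolvent_const_left hlam₀)
    have hd : (l.comp (ContinuousLinearMap.apply ℂ E ξ)) (-resolvent (A p₀) lam₀ ^ 2) = -1 := by
      simp [pow_two, hRξ, hlξ]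
    exact hd ▸ h
  obtain ⟨lam, hlam, hlam0, hlamR⟩ := exists_analyticAt_implicit hfun hderiv (by simp)
  have hmem : lam p₀ ∈ resolventSet ℂ (A p₀) := hlam0 ▸ hlam₀
  have hR : AnalyticAt ℂ (fun p => resolvent (A p) (lam p)) p₀ :=
    analyticAt_resolvent hAan hlam hmem
  have hright : AnalyticAt ℂ (fun p => resolvent (A p) (lam p) ξ) p₀ :=
    ((ContinuousLinearMap.apply ℂ E ξ).analyticAt _).fun_comp hR
  have hleft : AnalyticAt ℂ (fun p => l.comp (resolvent (A p) (lam p))) p₀ :=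
    ((ContinuousLinearMap.compL ℂ E E ℂ l).analyticAt _).fun_comp hR
  have hpair : l (resolvent (A p₀) (lam p₀) (resolvent (A p₀) (lam p₀) ξ)) = 1 := by
    rw [hlam0, hlR, hRξ, hlξ]
  have hpair_ne := (((ContinuousLinearMap.analyticAt_bilinear (ContinuousLinearMap.id ℂ _) _).comp₂
    hleft hright).continuousAt.eventually_ne (hpair.trans_ne one_ne_zero))
  refine ⟨lam, fun p => lineProj (l.comp (resolvent (A p) (lam p))) (resolvent (A p) (lam p) ξ),
    hlam, analyticAt_lineProj hleft hright (hpair.trans_ne one_ne_zero), hlam0, ?_, ?_⟩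
  · ext f
    simp [lineProj_apply, hlam0, hlR, hRξ, hlξ]
  · filter_upwards [hlamR, hpair_ne,
      eventually_mem_resolventSet hAan.continuousAt hlam.continuousAt hmem] with p hp1 hp2 hp3
    exact isRankOneSplitting_of_resolvent hp3 (by rw [hp1, hRξ, hlξ]) hp2

end SimpleEigenvalue

theorem spectralRadius_lt_of_isCompactOperator {E : Type*} [NormedAddCommGroup E]
    [NormedSpace ℂ E] [CompleteSpace E] {T : E →L[ℂ] E} (hT : IsCompactOperator T) {r : NNReal}
    (hr : 0 < r) (h : ∀ k : ℂ, r ≤ ‖k‖₊ → ∀ f, T f = k • f → f = 0) :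
    spectralRadius ℂ T < r := by
  rcases subsingleton_or_nontrivial E with hE | hE
  · simpa using hr
  · refine spectrum.spectralRadius_lt_of_forall_lt T fun k hk => ?_
    by_contra! hrk
    have hk0 : k ≠ 0 := nnnorm_pos.1 (hr.trans_le hrk)
    obtain ⟨f, hf⟩ := ((hT.hasEigenvalue_iff_mem_spectrum hk0).2 hk).exists_hasEigenvector
    exact hf.2 (h k hrk f hf.apply_eq_smul)

theorem spectralRadius_sub_smulRight_lt_one {E : Type*} [NormedAddCommGroup E] [NormedSpace ℂ E]
    [CompleteSpace E] {T : E →L[ℂ] E} (hT : IsCompactOperator T) {ξ : E} {l : E →L[ℂ] ℂ}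
    (hlξ : l ξ = 1) (hl : ∀ f, l (T f) = l f)
    (h : ∀ k : ℂ, 1 ≤ ‖k‖ → ∀ f, T f = k • f → l f = 0 → f = 0) :
    spectralRadius ℂ (T - l.smulRight ξ) < 1 := by
  have hcompact : IsCompactOperator (T - l.smulRight ξ) :=
    (compactOperator (RingHom.id ℂ) E E).sub_mem (x := T) hT (isCompactOperator_smulRight l ξ)
  refine spectralRadius_lt_of_isCompactOperator hcompact one_pos fun k hk f hf => ?_
  replace hk : 1 ≤ ‖k‖ := hk
  rw [sub_apply, ContinuousLinearMap.smulRight_apply] at hf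
  have hlf : k * l f = 0 := by
    rw [← smul_eq_mul, ← map_smul, ← hf, map_sub, hl, map_smul, hlξ, smul_eq_mul, mul_one, sub_self]
  have hlf0 : l f = 0 := (mul_eq_zero.1 hlf).resolve_left (norm_pos_iff.1 (one_pos.trans_le hk))
  rw [hlf0, zero_smul, sub_zero] at hf
  exact h k hk f hf hlf0

theorem exists_analyticOnNhd_isRankOneSplitting {G E : Type*} [NormedAddCommGroup G]
    [NormedSpace ℂ G] [CompleteSpace G] [NormedAddCommGroup E] [NormedSpace ℂ E] [CompleteSpace E]
    {T : G → E →L[ℂ] E} {p₀ : G} {U : Set G} (hU : U ∈ 𝓝 p₀) (hT : AnalyticAt ℂ T p₀) {ξ : E}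
    {l : E →L[ℂ] ℂ} (hlξ : l ξ = 1) (hξ : T p₀ ξ = ξ) (hl : ∀ f, l (T p₀ f) = l f)
    (hr : spectralRadius ℂ (T p₀ - l.smulRight ξ) < 1) :
    ∃ V, IsOpen V ∧ p₀ ∈ V ∧ V ⊆ U ∧ ∃ (lam : G → ℂ) (P N : G → E →L[ℂ] E),
      AnalyticOnNhd ℂ lam V ∧ AnalyticOnNhd ℂ P V ∧ AnalyticOnNhd ℂ N V ∧
      (∀ p ∈ V, IsRankOneSplitting (T p) (lam p) (P p) (N p) ∧
        spectralRadius ℂ (N p) < 1 ∧ spectralRadius ℂ (N p) < ‖lam p‖ₑ) ∧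
      lam p₀ = 1 ∧ P p₀ = l.smulRight ξ := by
  have hres : (1 : ℂ) ∈ resolventSet ℂ (T p₀ - l.smulRight ξ) :=
    spectrum.mem_resolventSet_of_spectralRadius_lt (by simpa using hr)
  obtain ⟨lam, P, hlam, hP, hlam₀, hP₀, hsplit⟩ :=
    exists_analyticAt_isRankOneSplitting hT hlξ (by rw [hξ, one_smul])
      (by simpa only [one_mul] using hl) hres
  have hN : AnalyticAt ℂ (fun p => T p - lam p • P p) p₀ := hT.sub (hlam.smul hP)
  obtain ⟨r, hNr, hr1⟩ := exists_between hr
  have hrad : ∀ᶠ p in 𝓝 p₀, spectralRadius ℂ (T p - lam p • P p) < r :=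
    hN.continuousAt.eventually (eventually_spectralRadius_lt (by simpa [hlam₀, hP₀] using hNr))
  have hlam_gt : ∀ᶠ p in 𝓝 p₀, r < ‖lam p‖ₑ :=
    hlam.continuousAt.enorm.eventually (lt_mem_nhds (by simpa [hlam₀] using hr1))
  obtain ⟨V, hV, hVo, hVm⟩ := eventually_nhds_iff.1 <|
    hlam.eventually_analyticAt.and <| hP.eventually_analyticAt.and <|
      hN.eventually_analyticAt.and <| hsplit.and <| hrad.and <| hlam_gt.and hU
  exact ⟨V, hVo, hVm, fun p hp => (hV p hp).2.2.2.2.2.2, lam, P, fun p => T p - lam p • P p,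
    fun p hp => (hV p hp).1, fun p hp => (hV p hp).2.1, fun p hp => (hV p hp).2.2.1,
    fun p hp => have h := (hV p hp).2.2.2
      ⟨h.1, h.2.1.trans hr1, h.2.1.trans h.2.2.1⟩, hlam₀, hP₀⟩

/-! ### The Banach space of bounded holomorphic functions -/

section Hinf

theorem isOpen_disc : IsOpen disc := Metric.isOpen_ball

theorem center_mem_disc : (2 / 3 : ℂ) ∈ disc := Metric.mem_ball_self one_pos

theorem hval_coe (f : Hinf) (z : disc) : hval f z = f.1 z := zeroExt_apply _ z

theorem hval_of_notMem (f : Hinf) {z : ℂ} (hz : z ∉ disc) : hval f z = 0 :=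
  Function.extend_apply' _ _ _ (by rintro ⟨a, rfl⟩; exact hz a.2)

theorem differentiableOn_hval (f : Hinf) : DifferentiableOn ℂ (hval f) disc := f.2

theorem continuousOn_hval (f : Hinf) : ContinuousOn (hval f) disc :=
  (differentiableOn_hval f).continuousOn

theorem norm_hval_le (f : Hinf) (z : ℂ) : ‖hval f z‖ ≤ ‖f‖ := by
  by_cases hz : z ∈ disc
  · rw [hval_coe f ⟨z, hz⟩]
    exact f.1.norm_coe_le_norm _
  · rw [hval_of_notMem f hz, norm_zero]
    exact norm_nonneg f

theorem norm_le_of_hval {f : Hinf} {C : ℝ} (h : ∀ z ∈ disc, ‖hval f z‖ ≤ C) : ‖f‖ ≤ C := by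
  have : Nonempty disc := ⟨⟨_, center_mem_disc⟩⟩
  refine (BoundedContinuousFunction.norm_le_of_nonempty (f := f.1)).2 fun z => ?_
  exact hval_coe f z ▸ h z z.2

theorem hval_add (f g : Hinf) : hval (f + g) = hval f + hval g := by
  ext z
  by_cases hz : z ∈ disc
  · simp only [Pi.add_apply, hval_coe _ (⟨z, hz⟩ : disc)]
    rfl
  · simp only [Pi.add_apply, hval_of_notMem _ hz, add_zero]

theorem hval_smul (a : ℂ) (f : Hinf) : hval (a • f) = a • hval f := by
  ext z
  by_cases hz : z ∈ disc
  · simp only [Pi.smul_apply, hval_coe _ (⟨z, hz⟩ : disc)]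
    rfl
  · simp only [Pi.smul_apply, hval_of_notMem _ hz, smul_zero]

/-- Evaluation at a point, as a bounded functional on `Hinf`. -/
def evalAt (z : ℂ) : Hinf →L[ℂ] ℂ :=
  LinearMap.mkContinuous
    { toFun := fun f => hval f z
      map_add' := fun f g => congrFun (hval_add f g) z
      map_smul' := fun a f => congrFun (hval_smul a f) z } 1
    fun f => (norm_hval_le f z).trans_eq (one_mul _).symm

theorem evalAt_apply (z : ℂ) (f : Hinf) : evalAt z f = hval f z := rfl

/-- A bounded holomorphic function on the disc as an element of `Hinf`. -/
def ofBounded (g : ℂ → ℂ) (hg : DifferentiableOn ℂ g disc) (hC : ∃ C, ∀ z ∈ disc, ‖g z‖ ≤ C) :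
    Hinf :=
  ⟨BoundedContinuousFunction.ofNormedAddCommGroup (fun z : disc => g z)
      (continuousOn_iff_continuous_domRestrict.1 hg.continuousOn) hC.choose
      fun z => hC.choose_spec z z.2,
    hg.congr fun z hz => zeroExt_apply _ ⟨z, hz⟩⟩

theorem hval_ofBounded {g : ℂ → ℂ} {hg : DifferentiableOn ℂ g disc}
    {hC : ∃ C, ∀ z ∈ disc, ‖g z‖ ≤ C} {z : ℂ} (hz : z ∈ disc) : hval (ofBounded g hg hC) z = g z :=
  zeroExt_apply _ ⟨z, hz⟩

theorem isClosed_Hinf : IsClosed (Hinf : Set (disc →ᵇ ℂ)) := by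
  refine IsSeqClosed.isClosed fun u f hu hf => ?_
  rw [BoundedContinuousFunction.tendsto_iff_tendstoUniformly, Metric.tendstoUniformly_iff] at hf
  have hunif : TendstoUniformlyOn (fun n => zeroExt (u n)) (zeroExt f) atTop disc := by
    refine Metric.tendstoUniformlyOn_iff.2 fun ε hε => ?_
    filter_upwards [hf ε hε] with n hn z hz
    rw [zeroExt_apply _ ⟨z, hz⟩, zeroExt_apply _ ⟨z, hz⟩]
    exact hn ⟨z, hz⟩
  exact hunif.tendstoLocallyUniformlyOn.differentiableOn (Eventually.of_forall hu) isOpen_disc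

instance completeSpace_Hinf : CompleteSpace Hinf := isClosed_Hinf.completeSpace_coe

/-- The weighted composition operator `f ↦ h * (f ∘ ψ)`. -/
def weightedComp (h : Hinf) (ψ : ℂ → ℂ) (hψ : DifferentiableOn ℂ ψ disc)
    (hmaps : Set.MapsTo ψ disc disc) : Hinf →L[ℂ] Hinf :=
  have hbound (f : Hinf) (z : ℂ) : ‖hval h z * hval f (ψ z)‖ ≤ ‖h‖ * ‖f‖ :=
    norm_mul_le_of_le (norm_hval_le h z) (norm_hval_le f _)
  LinearMap.mkContinuous
    { toFun := fun f => ofBounded (fun z => hval h z * hval f (ψ z))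
        ((differentiableOn_hval h).mul ((differentiableOn_hval f).comp hψ hmaps))
        ⟨‖h‖ * ‖f‖, fun z _ => hbound f z⟩
      map_add' := fun f g => Hinf.ext_hval fun z hz => by
        simp only [hval_ofBounded hz, hval_add, Pi.add_apply, mul_add]
      map_smul' := fun a f => Hinf.ext_hval fun z hz => by
        simp only [hval_ofBounded hz, hval_smul, Pi.smul_apply, smul_eq_mul, RingHom.id_apply,
          mul_left_comm] } ‖h‖
    fun f => norm_le_of_hval fun z hz => (congrArg norm (hval_ofBounded hz)).trans_le (hbound f z)

theorem hval_weightedComp {h : Hinf} {ψ : ℂ → ℂ} {hψ : DifferentiableOn ℂ ψ disc}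
    {hmaps : Set.MapsTo ψ disc disc} (f : Hinf) {z : ℂ} (hz : z ∈ disc) :
    hval (weightedComp h ψ hψ hmaps f) z = hval h z * hval f (ψ z) :=
  hval_ofBounded hz

/-- The multiplication operator `f ↦ h * f`. -/
def mulOp (h : Hinf) : Hinf →L[ℂ] Hinf :=
  weightedComp h id differentiableOn_id (Set.mapsTo_id _)

theorem hval_mulOp (h f : Hinf) {z : ℂ} (hz : z ∈ disc) :
    hval (mulOp h f) z = hval h z * hval f z :=
  hval_weightedComp f hz

/-- The composition operator `f ↦ f ∘ ψ`. -/
def compOp (ψ : ℂ → ℂ) (hψ : DifferentiableOn ℂ ψ disc) (hmaps : Set.MapsTo ψ disc disc) :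
    Hinf →L[ℂ] Hinf :=
  weightedComp (ofBounded (fun _ => 1) (differentiableOn_const 1) ⟨1, fun _ _ => by simp⟩) ψ hψ
    hmaps

theorem hval_compOp {ψ : ℂ → ℂ} {hψ : DifferentiableOn ℂ ψ disc} {hmaps : Set.MapsTo ψ disc disc}
    (f : Hinf) {z : ℂ} (hz : z ∈ disc) : hval (compOp ψ hψ hmaps f) z = hval f (ψ z) := by
  rw [compOp, hval_weightedComp f hz, hval_ofBounded hz, one_mul]

theorem analyticAt_hval (f : Hinf) {z : ℂ} (hz : z ∈ disc) : AnalyticAt ℂ (hval f) z :=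
  (differentiableOn_hval f).analyticAt (isOpen_disc.mem_nhds hz)

theorem norm_inv_factorial_mul_iteratedDeriv_le (k : ℕ) (f : Hinf) :
    ‖(k.factorial : ℂ)⁻¹ * iteratedDeriv k (hval f) (2 / 3)‖ ≤ ‖f‖ := by
  have hcauchy : ∀ r ∈ Set.Ioo (0 : ℝ) 1,
      ‖(k.factorial : ℂ)⁻¹ * iteratedDeriv k (hval f) (2 / 3)‖ ≤ ‖f‖ / r ^ k := fun r hr => by
    have hball : closure (Metric.ball (2 / 3 : ℂ) r) ⊆ disc :=
      Metric.closure_ball_subset_closedBall.trans (Metric.closedBall_subset_ball hr.2)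
    have h := Complex.norm_iteratedDeriv_le_of_forall_mem_sphere_norm_le k hr.1
      ((differentiableOn_hval f).mono hball).diffContOnCl fun z _ => norm_hval_le f z
    rw [norm_mul, norm_inv, Complex.norm_natCast, inv_mul_le_iff₀ (by positivity)]
    exact h.trans_eq (mul_div_assoc _ _ _)
  have hlim : Tendsto (fun r : ℝ => ‖f‖ / r ^ k) (𝓝[<] 1) (𝓝 ‖f‖) := by
    have h : ContinuousAt (fun r : ℝ => ‖f‖ / r ^ k) 1 := by fun_prop (disch := simp)
    simpa only [one_pow, div_one] using h.tendsto.mono_left nhdsWithin_le_nhds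
  exact ge_of_tendsto hlim <| Filter.mem_of_superset (Ioo_mem_nhdsLT one_pos) hcauchy

/-- The Taylor coefficient of order `k` at the centre of the disc. -/
def taylorCoeff (k : ℕ) : Hinf →L[ℂ] ℂ :=
  LinearMap.mkContinuous
    { toFun := fun f => (k.factorial : ℂ)⁻¹ * iteratedDeriv k (hval f) (2 / 3)
      map_add' := fun f g => by
        rw [hval_add, iteratedDeriv_add (analyticAt_hval f center_mem_disc).contDiffAt
          (analyticAt_hval g center_mem_disc).contDiffAt, mul_add]
      map_smul' := fun a f => by
        rw [hval_smul, iteratedDeriv_const_smul_field, RingHom.id_apply, smul_eq_mul, smul_eq_mul,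
          mul_left_comm] } 1
    fun f => (norm_inv_factorial_mul_iteratedDeriv_le k f).trans_eq (one_mul _).symm

theorem norm_taylorCoeff_le (k : ℕ) : ‖taylorCoeff k‖ ≤ 1 :=
  LinearMap.mkContinuous_norm_le _ zero_le_one _

theorem hasSum_taylorCoeff (f : Hinf) {z : ℂ} (hz : z ∈ disc) :
    HasSum (fun k => taylorCoeff k f * (z - 2 / 3) ^ k) (hval f z) := by
  refine (Complex.hasSum_taylorSeries_on_ball (differentiableOn_hval f) hz).congr_fun fun k => ?_
  change (k.factorial : ℂ)⁻¹ * iteratedDeriv k (hval f) (2 / 3) * (z - 2 / 3) ^ k = _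
  rw [smul_eq_mul, smul_eq_mul]
  ring

theorem isCompactOperator_compOp {ψ : ℂ → ℂ} (hψ : DifferentiableOn ℂ ψ disc) {r : ℝ} (hr0 : 0 ≤ r)
    (hr1 : r < 1) (hmaps : Set.MapsTo ψ disc (Metric.closedBall (2 / 3) r)) :
    IsCompactOperator
      (compOp ψ hψ (hmaps.mono_right (Metric.closedBall_subset_ball hr1))) := by
  have hpow : ∀ (k : ℕ), ∀ z ∈ disc, ‖(ψ z - 2 / 3) ^ k‖ ≤ r ^ k := fun k z hz => by
    rw [norm_pow]
    exact pow_le_pow_left₀ (norm_nonneg _) (mem_closedBall_iff_norm.1 (hmaps hz)) k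
  let e (k : ℕ) : Hinf :=
    ofBounded (fun z => (ψ z - 2 / 3) ^ k) ((hψ.sub_const _).pow k) ⟨_, hpow k⟩
  have hval_e : ∀ k, ∀ z ∈ disc, hval (e k) z = (ψ z - 2 / 3) ^ k := fun k z hz =>
    hval_ofBounded hz
  have hsum : Summable fun k => ‖taylorCoeff k‖ * ‖e k‖ := by
    refine (summable_geometric_of_lt_one hr0 hr1).of_nonneg_of_le (fun _ => by positivity)
      fun k => ?_
    have he : ‖e k‖ ≤ r ^ k := norm_le_of_hval fun z hz => (hval_e k z hz).symm ▸ hpow k z hz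
    exact (mul_le_mul (norm_taylorCoeff_le k) he (norm_nonneg _) zero_le_one).trans_eq (one_mul _)
  have htaylor : compOp ψ hψ (hmaps.mono_right (Metric.closedBall_subset_ball hr1)) =
      ∑' k, (taylorCoeff k).smulRight (e k) := by
    refine ContinuousLinearMap.ext fun f => Hinf.ext_hval fun z hz => ?_
    rw [hval_compOp f hz]
    refine (hasSum_taylorCoeff f (Metric.closedBall_subset_ball hr1 (hmaps hz))).unique ?_
    refine ((summable_smulRight hsum).hasSum.mapL
      ((evalAt z).comp (ContinuousLinearMap.apply ℂ Hinf f))).congr_fun fun k => ?_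
    change _ = hval (taylorCoeff k f • e k) z
    rw [hval_smul, Pi.smul_apply, hval_e k z hz, smul_eq_mul]
  exact htaylor ▸ isCompactOperator_of_nuclear hsum

end Hinf

/-! ### The transfer operators -/

section TransferOp

theorem neg_third_le_re {z : ℂ} (hz : z ∈ Metric.closedBall (2 / 3) 1) : -(1 / 3) ≤ z.re := by
  have h : |(z - 2 / 3).re| ≤ 1 := (Complex.abs_re_le_norm _).trans (mem_closedBall_iff_norm.1 hz)
  have hre : (z - 2 / 3).re = z.re - 2 / 3 := by simp
  linarith [(abs_le.1 (hre ▸ h)).1]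

theorem ofReal_mem_disc {x : ℝ} (hx : x ∈ Set.Icc 0 1) : (x : ℂ) ∈ disc := by
  have h : (x : ℂ) - 2 / 3 = ((x - 2 / 3 : ℝ) : ℂ) := by push_cast; rfl
  rw [disc, mem_ball_iff_norm, h, Complex.norm_real, Real.norm_eq_abs, abs_lt]
  constructor <;> linarith [hx.1, hx.2]

theorem two_thirds_mul_le_re_add {z : ℂ} (hz : z ∈ Metric.closedBall (2 / 3) 1) (n : ℕ) :
    2 / 3 * ((n + 1 : ℕ) : ℝ) ≤ (z + (n + 1 : ℕ)).re := by
  rw [Complex.add_re, Complex.natCast_re]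
  push_cast
  linarith [neg_third_le_re hz, (Nat.cast_nonneg n : (0 : ℝ) ≤ n)]

theorem two_thirds_le_re_add {z : ℂ} (hz : z ∈ Metric.closedBall (2 / 3) 1) (n : ℕ) :
    2 / 3 ≤ (z + (n + 1 : ℕ)).re := by
  refine le_trans ?_ (two_thirds_mul_le_re_add hz n)
  exact le_mul_of_one_le_right (by norm_num) (by exact_mod_cast n.succ_pos)

theorem add_natCast_succ_mem_slitPlane {z : ℂ} (hz : z ∈ Metric.closedBall (2 / 3) 1) (n : ℕ) :
    z + (n + 1 : ℕ) ∈ Complex.slitPlane :=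
  Or.inl (lt_of_lt_of_le (by norm_num) (two_thirds_le_re_add hz n))

theorem disc_subset_closedBall : disc ⊆ Metric.closedBall (2 / 3) 1 :=
  Metric.ball_subset_closedBall

theorem add_natCast_succ_ne_zero {z : ℂ} (hz : z ∈ disc) (n : ℕ) : z + (n + 1 : ℕ) ≠ 0 :=
  Complex.slitPlane_ne_zero (add_natCast_succ_mem_slitPlane (disc_subset_closedBall hz) n)

theorem one_div_mem_closedBall {w : ℂ} (hw : 2 / 3 ≤ w.re) :
    1 / w ∈ Metric.closedBall (2 / 3 : ℂ) (5 / 6) := by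
  have hw0 : w ≠ 0 := fun h => by
    rw [h, Complex.zero_re] at hw
    linarith
  have hnorm : ‖4 - 3 * w‖ ≤ 3 * ‖w‖ := by
    refine le_of_sq_le_sq ?_ (by positivity)
    rw [mul_pow, ← Complex.normSq_eq_norm_sq, ← Complex.normSq_eq_norm_sq, Complex.normSq_apply,
      Complex.normSq_apply]
    simp only [Complex.sub_re, Complex.sub_im, Complex.re_ofNat, Complex.im_ofNat, Complex.mul_re,
      Complex.mul_im, zero_mul, sub_zero, add_zero, zero_sub]
    nlinarith
  have hball : 1 / w ∈ Metric.closedBall (3 / 4 : ℂ) (3 / 4) := by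
    have h : 1 / w - 3 / 4 = (4 - 3 * w) / (4 * w) := by field_simp
    have hpos : 0 < ‖w‖ := norm_pos_iff.2 hw0
    rw [mem_closedBall_iff_norm, h, norm_div, norm_mul, Complex.norm_ofNat,
      div_le_iff₀ (mul_pos four_pos hpos)]
    linarith
  refine Metric.closedBall_subset_closedBall' ?_ hball
  have hcenters : (3 / 4 : ℂ) - 2 / 3 = (1 / 12 : ℝ) := by norm_num
  rw [dist_eq_norm, hcenters, Complex.norm_real]
  norm_num

theorem mapsTo_one_div_add (n : ℕ) :
    Set.MapsTo (fun z : ℂ => 1 / (z + (n + 1 : ℕ))) disc (Metric.closedBall (2 / 3) (5 / 6)) :=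
  fun _ hz => one_div_mem_closedBall (two_thirds_le_re_add (disc_subset_closedBall hz) n)

theorem closedBall_subset_disc : Metric.closedBall (2 / 3 : ℂ) (5 / 6) ⊆ disc :=
  Metric.closedBall_subset_ball (by norm_num)

theorem differentiableOn_one_div_add (n : ℕ) :
    DifferentiableOn ℂ (fun z : ℂ => 1 / (z + (n + 1 : ℕ))) disc := fun z hz => by
  have := add_natCast_succ_ne_zero hz n
  exact DifferentiableAt.differentiableWithinAt (by fun_prop (disch := assumption))

theorem norm_cpow_neg_le {z : ℂ} (hz : z ∈ disc) (n : ℕ) {w : ℂ} {a b : ℝ} (ha : 0 ≤ a)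
    (haw : a ≤ w.re) (hwb : ‖w‖ ≤ b) :
    ‖(z + (n + 1 : ℕ)) ^ (-w)‖ ≤
      (3 / 2) ^ b * Real.exp (Real.pi * b) * ((n + 1 : ℕ) : ℝ) ^ (-a) := by
  have hn : (1 : ℝ) ≤ (n + 1 : ℕ) := by exact_mod_cast n.succ_pos
  have hlower : 2 / 3 * ((n + 1 : ℕ) : ℝ) ≤ ‖z + (n + 1 : ℕ)‖ :=
    (two_thirds_mul_le_re_add (disc_subset_closedBall hz) n).trans (Complex.re_le_norm _)
  rw [Complex.norm_cpow_of_ne_zero (add_natCast_succ_ne_zero hz n), div_eq_mul_inv,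
    ← Real.exp_neg, Complex.neg_re, Complex.neg_im]
  have hmodulus : ‖z + (n + 1 : ℕ)‖ ^ (-w.re) ≤ (3 / 2) ^ b * ((n + 1 : ℕ) : ℝ) ^ (-a) := by
    calc ‖z + (n + 1 : ℕ)‖ ^ (-w.re) ≤ (2 / 3 * ((n + 1 : ℕ) : ℝ)) ^ (-w.re) :=
          Real.rpow_le_rpow_of_nonpos (by positivity) hlower (by linarith)
      _ = (3 / 2) ^ w.re * ((n + 1 : ℕ) : ℝ) ^ (-w.re) := by
          rw [Real.mul_rpow (by norm_num) (by positivity), Real.rpow_neg (by norm_num),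
            ← Real.inv_rpow (by norm_num), inv_div]
      _ ≤ (3 / 2) ^ b * ((n + 1 : ℕ) : ℝ) ^ (-a) := by
          gcongr
          · norm_num
          · exact (Complex.re_le_norm w).trans hwb
  have hargument : Real.exp (-((z + (n + 1 : ℕ)).arg * -w.im)) ≤ Real.exp (Real.pi * b) := by
    refine Real.exp_le_exp.2 ?_
    calc -((z + (n + 1 : ℕ)).arg * -w.im) = (z + (n + 1 : ℕ)).arg * w.im := by ring
      _ ≤ |(z + (n + 1 : ℕ)).arg| * |w.im| := (le_abs_self _).trans_eq (abs_mul _ _)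
      _ ≤ Real.pi * b := by
        gcongr
        · exact Complex.abs_arg_le_pi _
        · exact (Complex.abs_im_le_norm w).trans hwb
  exact (mul_le_mul hmodulus hargument (by positivity) (by positivity)).trans_eq
    (mul_right_comm _ _ _)

theorem differentiableOn_log_add (n : ℕ) :
    DifferentiableOn ℂ (fun z : ℂ => Complex.log (z + (n + 1 : ℕ))) (Metric.closedBall (2 / 3) 1) :=
  fun _ hz => ((differentiableAt_id.add_const _).clog
    (add_natCast_succ_mem_slitPlane hz n)).differentiableWithinAt

theorem exists_norm_log_add_le (n : ℕ) :
    ∃ C, ∀ z ∈ disc, ‖Complex.log (z + (n + 1 : ℕ))‖ ≤ C := by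
  obtain ⟨C, hC⟩ := (isCompact_closedBall (2 / 3 : ℂ) 1).exists_bound_of_continuousOn
    (differentiableOn_log_add n).continuousOn
  exact ⟨C, fun z hz => hC z (disc_subset_closedBall hz)⟩

/-- The branch operator `f ↦ (z + n + 1) ^ (-w) * f (1 / (z + n + 1))`. -/
def branchOp (n : ℕ) (w : ℂ) : Hinf →L[ℂ] Hinf :=
  expComp (mulOp (ofBounded (fun z => Complex.log (z + (n + 1 : ℕ)))
      ((differentiableOn_log_add n).mono disc_subset_closedBall) (exists_norm_log_add_le n)))
    (compOp (fun z => 1 / (z + (n + 1 : ℕ))) (differentiableOn_one_div_add n)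
      ((mapsTo_one_div_add n).mono_right closedBall_subset_disc)) (-w)

theorem hval_branchOp (n : ℕ) (w : ℂ) (f : Hinf) {z : ℂ} (hz : z ∈ disc) :
    hval (branchOp n w f) z =
      (z + (n + 1 : ℕ)) ^ (-w) * hval f (1 / (z + (n + 1 : ℕ))) := by
  have h := map_expComp_apply (evalAt z) (fun g => hval_mulOp (ofBounded
      (fun z => Complex.log (z + (n + 1 : ℕ))) ((differentiableOn_log_add n).mono
        disc_subset_closedBall) (exists_norm_log_add_le n)) g hz) (compOp _
    (differentiableOn_one_div_add n) ((mapsTo_one_div_add n).mono_right closedBall_subset_disc))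
    (-w) f
  rw [evalAt_apply, evalAt_apply, hval_compOp f hz, hval_ofBounded hz, mul_comm (-w)] at h
  rw [Complex.cpow_def_of_ne_zero (add_natCast_succ_ne_zero hz n)]
  exact h

theorem differentiable_branchOp (n : ℕ) : Differentiable ℂ (branchOp n) :=
  (differentiable_expComp (mulOp _) (compOp _ _ _)).comp differentiable_neg

theorem isCompactOperator_branchOp (n : ℕ) (w : ℂ) : IsCompactOperator (branchOp n w) :=
  isCompactOperator_expComp _
    (isCompactOperator_compOp _ (by norm_num) (by norm_num) (mapsTo_one_div_add n)) _

theorem norm_branchOp_le (n : ℕ) {w : ℂ} {a b : ℝ} (ha : 0 ≤ a) (haw : a ≤ w.re) (hwb : ‖w‖ ≤ b) :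
    ‖branchOp n w‖ ≤ (3 / 2) ^ b * Real.exp (Real.pi * b) * ((n + 1 : ℕ) : ℝ) ^ (-a) := by
  refine ContinuousLinearMap.opNorm_le_bound _ (by positivity) fun f => ?_
  refine norm_le_of_hval fun z hz => ?_
  rw [hval_branchOp n w f hz]
  exact norm_mul_le_of_le (norm_cpow_neg_le hz n ha haw hwb) (norm_hval_le f _)

theorem exists_summable_norm_branchOp_le {w₀ : ℂ} (hw₀ : 1 < w₀.re) :
    ∃ O : Set ℂ, IsOpen O ∧ w₀ ∈ O ∧
      ∃ u : ℕ → ℝ, Summable u ∧ ∀ n, ∀ w ∈ O, ‖branchOp n w‖ ≤ u n := by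
  obtain ⟨a, ha, haw⟩ := exists_between hw₀
  refine ⟨{w | a < w.re} ∩ {w | ‖w‖ < ‖w₀‖ + 1},
    (isOpen_lt continuous_const Complex.continuous_re).inter
      (isOpen_lt continuous_norm continuous_const), ⟨haw, lt_add_one ‖w₀‖⟩, _, ?_,
    fun n w hw => norm_branchOp_le n (zero_le_one.trans ha.le) hw.1.le hw.2.le⟩
  exact ((summable_nat_add_iff 1).2 (Real.summable_nat_rpow.2 (neg_lt_neg ha))).mul_left _

/-- The operator `∑ n, exp (ω * a n) • branchOp (n + m) w`, which is the transfer operator over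
the branches from `m + 1` on when `a n = c (n + m + 1)` and `w = 2s + μω`. -/
def branchSeries (m : ℕ) (a : ℕ →ᵇ ℂ) (w ω : ℂ) : Hinf →L[ℂ] Hinf :=
  seriesOp (fun n => branchOp (n + m) w) (NormedSpace.exp (ω • a))

theorem hasSum_hval_branchSeries (m : ℕ) (a : ℕ →ᵇ ℂ) {w : ℂ} (hw : 1 < w.re) (ω : ℂ) (f : Hinf)
    {z : ℂ} (hz : z ∈ disc) :
    HasSum (fun n => Complex.exp (ω * a n) *
        ((z + (n + m + 1 : ℕ)) ^ (-w) * hval f (1 / (z + (n + m + 1 : ℕ)))))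
      (hval (branchSeries m a w ω f) z) := by
  obtain ⟨O, -, hwO, u, hu, hbound⟩ := exists_summable_norm_branchOp_le hw
  have h := hasSum_map_seriesOp_exp_apply ((summable_nat_add_iff m).2 hu)
    (fun n => hbound (n + m) w hwO) a ω (evalAt z) f
  simp only [evalAt_apply, hval_branchOp _ w f hz] at h
  exact h

theorem isCompactOperator_branchSeries (m : ℕ) (a : ℕ →ᵇ ℂ) {w : ℂ} (hw : 1 < w.re) (ω : ℂ) :
    IsCompactOperator (branchSeries m a w ω) := by
  obtain ⟨O, -, hwO, u, hu, hbound⟩ := exists_summable_norm_branchOp_le hw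
  exact isCompactOperator_seriesOp_exp ((summable_nat_add_iff m).2 hu)
    (fun n => hbound (n + m) w hwO) (fun n => isCompactOperator_branchOp (n + m) w) a ω

theorem analyticAt_branchSeries (m : ℕ) (a : ℕ →ᵇ ℂ) {G : Type*} [NormedAddCommGroup G]
    [NormedSpace ℂ G] {w ω : G → ℂ} {p : G} (hw : AnalyticAt ℂ w p) (hω : AnalyticAt ℂ ω p)
    (hwp : 1 < (w p).re) : AnalyticAt ℂ (fun q => branchSeries m a (w q) (ω q)) p := by
  obtain ⟨O, hO, hwO, u, hu, hbound⟩ := exists_summable_norm_branchOp_le hwp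
  exact analyticAt_seriesOp_exp hO
    (fun n => (differentiable_branchOp (n + m)).differentiableOn)
    ((summable_nat_add_iff m).2 hu) (fun n => hbound (n + m)) a hw hω hwO

/-- The pairs `(s, ω)` with `Re s > 1/2` for which the series of the transfer operators converge
absolutely. -/
def convergenceDomain (c : ℕ → ℝ) : Set (ℂ × ℂ) :=
  {p | 1 / 2 < p.1.re ∧ 1 < (2 * p.1 + (mean c : ℂ) * p.2).re}

theorem isOpen_convergenceDomain (c : ℕ → ℝ) : IsOpen (convergenceDomain c) :=
  (isOpen_lt (by fun_prop) (by fun_prop)).and (isOpen_lt (by fun_prop) (by fun_prop))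

theorem mk_zero_mem_convergenceDomain (c : ℕ → ℝ) {s : ℂ} (hs : 1 / 2 < s.re) :
    (s, (0 : ℂ)) ∈ convergenceDomain c := by
  refine ⟨hs, ?_⟩
  have h : (2 * s + (mean c : ℂ) * 0).re = 2 * s.re := by simp
  exact h ▸ (by linarith)

/-- The cost function from `m + 1` on, as a bounded sequence. -/
def costSeq (c : ℕ → ℝ) (hc : ∃ M : ℝ, ∀ n, 1 ≤ n → |c n| ≤ M) (m : ℕ) : ℕ →ᵇ ℂ :=
  BoundedContinuousFunction.ofNormedAddCommGroupDiscrete (fun n => (c (n + m + 1) : ℂ)) hc.choose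
    fun _ => (Complex.norm_real _).trans_le (hc.choose_spec _ (Nat.succ_pos _))

theorem transferOp_eq_of_isTransferOp {c : ℕ → ℝ} {m : ℕ} {s ω : ℂ} {A : Hinf →L[ℂ] Hinf}
    (hA : IsTransferOp c m s ω A) : transferOp c m s ω = A := by
  have h : ∃ A, IsTransferOp c m s ω A := ⟨A, hA⟩
  rw [transferOp, dif_pos h]
  exact h.choose_spec.unique hA

variable {c : ℕ → ℝ}

theorem isTransferOp_branchSeries (hc : ∃ M : ℝ, ∀ n, 1 ≤ n → |c n| ≤ M) (m : ℕ)
    {s ω : ℂ} (hp : (s, ω) ∈ convergenceDomain c) :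
    IsTransferOp c (m + 1) s ω
      (branchSeries m (costSeq c hc m) (2 * s + (mean c : ℂ) * ω) ω) := fun f z hz => by
  refine (hasSum_hval_branchSeries m _ hp.2 ω f hz).congr_fun fun n => ?_
  rw [weight, div_eq_mul_inv, ← Complex.cpow_neg, mul_assoc]
  rfl

theorem isTransferOp_transferOp (hc : ∃ M : ℝ, ∀ n, 1 ≤ n → |c n| ≤ M) (m : ℕ)
    {s ω : ℂ} (hp : (s, ω) ∈ convergenceDomain c) :
    IsTransferOp c (m + 1) s ω (transferOp c (m + 1) s ω) := by
  have h := isTransferOp_branchSeries hc m hp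
  rwa [transferOp_eq_of_isTransferOp h]

theorem isCompactOperator_transferOp (hc : ∃ M : ℝ, ∀ n, 1 ≤ n → |c n| ≤ M) (m : ℕ)
    {s ω : ℂ} (hp : (s, ω) ∈ convergenceDomain c) :
    IsCompactOperator (transferOp c (m + 1) s ω) := by
  rw [transferOp_eq_of_isTransferOp (isTransferOp_branchSeries hc m hp)]
  exact isCompactOperator_branchSeries m _ hp.2 ω

theorem analyticOnNhd_transferOp (hc : ∃ M : ℝ, ∀ n, 1 ≤ n → |c n| ≤ M) (m : ℕ) :
    AnalyticOnNhd ℂ (fun p : ℂ × ℂ => transferOp c (m + 1) p.1 p.2) (convergenceDomain c) := by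
  have heq : Set.EqOn (fun p : ℂ × ℂ =>
      branchSeries m (costSeq c hc m) (2 * p.1 + (mean c : ℂ) * p.2) p.2)
      (fun p => transferOp c (m + 1) p.1 p.2) (convergenceDomain c) := fun p hp =>
    (transferOp_eq_of_isTransferOp (isTransferOp_branchSeries hc m hp)).symm
  refine AnalyticOnNhd.congr (isOpen_convergenceDomain c) (fun p hp => ?_) heq
  exact analyticAt_branchSeries m _
    ((analyticAt_const.mul analyticAt_fst).add (analyticAt_const.mul analyticAt_snd))
    analyticAt_snd hp.2

end TransferOp

/-! ### The action on integrable functions -/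

section GaussBranches

/-- The inverse branch `x ↦ 1 / (x + n + 1)` of the Gauss map. -/
def branch (n : ℕ) (x : ℝ) : ℝ := 1 / (x + ((n + 1 : ℕ) : ℝ))

/-- The image of `[0, 1)` under an inverse branch, in a form whose union over `n` telescopes. -/
def branchIoc (n : ℕ) : Set ℝ :=
  Set.Ioc (1 / ((n + 1 : ℕ) + 1 : ℝ)) (1 / ((n : ℕ) + 1 : ℝ))

theorem leb01_eq_restrict_Ico : leb01 = volume.restrict (Set.Ico 0 1) :=
  Measure.restrict_congr_set Ico_ae_eq_Icc.symm

theorem leb01_eq_restrict_Ioc : leb01 = volume.restrict (Set.Ioc 0 1) :=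
  Measure.restrict_congr_set Ioc_ae_eq_Icc.symm

theorem measurableSet_branchIoc (n : ℕ) : MeasurableSet (branchIoc n) := measurableSet_Ioc

theorem iUnion_branchIoc : ⋃ n, branchIoc n = Set.Ioc 0 1 := by
  ext x
  simp only [Set.mem_iUnion, branchIoc, Set.mem_Ioc]
  constructor
  · rintro ⟨n, hlower, hupper⟩
    refine ⟨lt_trans (by positivity) hlower, hupper.trans ?_⟩
    rw [div_le_one (by positivity)]
    exact le_add_of_nonneg_left (Nat.cast_nonneg n)
  · rintro ⟨h0, h1⟩
    have hfloor : 1 ≤ ⌊1 / x⌋₊ := Nat.one_le_floor_iff _ |>.2 ((one_le_div h0).2 h1)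
    obtain ⟨n, hn⟩ := Nat.exists_eq_add_of_le' hfloor
    have hlower := Nat.lt_floor_add_one (1 / x)
    have hupper := Nat.floor_le (one_div_pos.2 h0).le
    rw [hn] at hlower hupper
    refine ⟨n, ?_, ?_⟩
    · rwa [div_lt_comm₀ (by positivity) h0]
    · rw [le_div_comm₀ h0 (by positivity)]
      exact_mod_cast hupper

theorem leb01_eq_restrict_iUnion_branchIoc : leb01 = volume.restrict (⋃ n, branchIoc n) := by
  rw [leb01_eq_restrict_Ioc, iUnion_branchIoc]

theorem restrict_branchIoc_le (n : ℕ) : volume.restrict (branchIoc n) ≤ leb01 := by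
  rw [leb01_eq_restrict_iUnion_branchIoc]
  exact Measure.restrict_mono (Set.subset_iUnion _ n) le_rfl

theorem pairwise_disjoint_branchIoc : Pairwise (Function.onFun Disjoint branchIoc) :=
  Antitone.pairwise_disjoint_on_Ioc_succ fun _ _ h => Nat.one_div_le_one_div h

theorem injOn_branch (n : ℕ) : Set.InjOn (branch n) (Set.Ico 0 1) := fun x _ y _ h => by
  simpa [branch] using h

theorem image_branch (n : ℕ) : branch n '' Set.Ico 0 1 = branchIoc n := by
  ext y
  simp only [Set.mem_image, Set.mem_Ico, branchIoc, Set.mem_Ioc, branch]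
  have hn : (0 : ℝ) < n + 1 := by positivity
  push_cast
  constructor
  · rintro ⟨x, ⟨h0, h1⟩, rfl⟩
    exact ⟨one_div_lt_one_div_of_lt (by positivity) (by linarith),
      one_div_le_one_div_of_le hn (by linarith)⟩
  · rintro ⟨hlower, hupper⟩
    have hy : 0 < y := lt_trans (by positivity) hlower
    rw [div_lt_comm₀ (by positivity) hy] at hlower
    rw [le_div_comm₀ hy hn] at hupper
    exact ⟨1 / y - (n + 1), ⟨by linarith, by linarith⟩, by simp⟩

theorem gaussMap_branch (n : ℕ) {x : ℝ} (hx : x ∈ Set.Ico (0 : ℝ) 1) :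
    gaussMap (branch n x) = x := by
  have h : 1 / branch n x = x + ((n + 1 : ℕ) : ℝ) := by rw [branch, one_div_one_div]
  rw [gaussMap, h, Int.floor_add_natCast, Int.floor_eq_zero_iff.2 hx]
  push_cast
  ring

theorem hasDerivWithinAt_branch (n : ℕ) {x : ℝ} (hx : x ∈ Set.Ico (0 : ℝ) 1) :
    HasDerivWithinAt (branch n) (-(1 / (x + ((n + 1 : ℕ) : ℝ)) ^ 2)) (Set.Ico 0 1) x := by
  have h0 := hx.1
  have h := (((hasDerivAt_id x).add_const ((n + 1 : ℕ) : ℝ)).inv (by positivity)).hasDerivWithinAt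
    (s := Set.Ico (0 : ℝ) 1)
  rw [neg_div] at h
  exact h.congr_of_mem (fun y _ => one_div _) hx

theorem abs_neg_one_div_sq (a : ℝ) : |-(1 / a ^ 2)| = 1 / a ^ 2 := by
  rw [abs_neg, abs_of_nonneg (by positivity)]

end GaussBranches

section GaussTerm

variable {E : Type*} [NormedAddCommGroup E] [NormedSpace ℝ E]

/-- The summand `f (1 / (x + n + 1)) / (x + n + 1) ^ 2` of the Gauss-Kuzmin-Wirsing operator. -/
def gaussTerm (n : ℕ) (f : ℝ → E) (x : ℝ) : E :=
  (1 / (x + ((n + 1 : ℕ) : ℝ)) ^ 2) • f (branch n x)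

theorem norm_gaussTerm (n : ℕ) (f : ℝ → E) (x : ℝ) :
    ‖gaussTerm n f x‖ = gaussTerm n (fun y => ‖f y‖) x := by
  rw [gaussTerm, norm_smul, Real.norm_of_nonneg (by positivity)]
  rfl

theorem integrable_gaussTerm_iff (n : ℕ) (f : ℝ → E) :
    Integrable (gaussTerm n f) leb01 ↔ IntegrableOn f (branchIoc n) := by
  have h := integrableOn_image_iff_integrableOn_abs_deriv_smul measurableSet_Ico
    (fun _ hx => hasDerivWithinAt_branch n hx) (injOn_branch n) f
  simp only [abs_neg_one_div_sq] at h
  rw [← image_branch, h, leb01_eq_restrict_Ico]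
  rfl

theorem integral_gaussTerm (n : ℕ) (f : ℝ → E) :
    ∫ x, gaussTerm n f x ∂leb01 = ∫ x in branchIoc n, f x := by
  have h := integral_image_eq_integral_abs_deriv_smul measurableSet_Ico
    (fun _ hx => hasDerivWithinAt_branch n hx) (injOn_branch n) f
  simp only [abs_neg_one_div_sq] at h
  rw [← image_branch, h, leb01_eq_restrict_Ico]
  rfl

theorem integral_norm_gaussTerm (n : ℕ) (f : ℝ → E) :
    ∫ x, ‖gaussTerm n f x‖ ∂leb01 = ∫ x in branchIoc n, ‖f x‖ := by
  simp only [norm_gaussTerm, integral_gaussTerm]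

theorem integrable_gaussTerm (n : ℕ) {f : ℝ → E} (hf : Integrable f leb01) :
    Integrable (gaussTerm n f) leb01 :=
  (integrable_gaussTerm_iff n f).2 (hf.mono_measure (restrict_branchIoc_le n))

theorem hasSum_integral_branchIoc {f : ℝ → E} (hf : Integrable f leb01) :
    HasSum (fun n => ∫ x in branchIoc n, f x) (∫ x, f x ∂leb01) := by
  rw [leb01_eq_restrict_iUnion_branchIoc] at hf ⊢
  exact hasSum_integral_iUnion measurableSet_branchIoc pairwise_disjoint_branchIoc hf

theorem gaussTerm_congr_ae (n : ℕ) {f g : ℝ → E} (hfg : f =ᵐ[leb01] g) :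
    gaussTerm n f =ᵐ[leb01] gaussTerm n g := by
  have hsub : f - g =ᵐ[leb01] 0 := hfg.mono fun x hx => sub_eq_zero.2 hx
  have hzero : ∫ x, ‖gaussTerm n (f - g) x‖ ∂leb01 = 0 := by
    rw [integral_norm_gaussTerm]
    have hres : f - g =ᵐ[volume.restrict (branchIoc n)] 0 := ae_mono (restrict_branchIoc_le n) hsub
    exact integral_eq_zero_of_ae (hres.mono fun x hx => norm_eq_zero.2 hx)
  rw [integral_eq_zero_iff_of_nonneg (fun _ => norm_nonneg _) (integrable_gaussTerm n
    ((integrable_zero ℝ E leb01).congr hsub.symm)).norm] at hzero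
  filter_upwards [hzero] with x hx
  rw [← sub_eq_zero, ← norm_eq_zero.1 hx, gaussTerm, gaussTerm, gaussTerm, Pi.sub_apply, smul_sub]

theorem gaussTerm_comp_gaussMap (n : ℕ) (f : ℝ → E) {x : ℝ} (hx : x ∈ Set.Ico (0 : ℝ) 1) :
    gaussTerm n (fun y => f (gaussMap y)) x = (1 / (x + ((n + 1 : ℕ) : ℝ)) ^ 2) • f x := by
  rw [gaussTerm, gaussMap_branch n hx]

theorem ae_mem_Ico : ∀ᵐ x ∂leb01, x ∈ Set.Ico (0 : ℝ) 1 := by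
  rw [leb01_eq_restrict_Ico]
  exact ae_restrict_mem measurableSet_Ico

theorem ae_norm_gaussTerm_comp_gaussMap_le (n : ℕ) (f : ℝ → E) :
    ∀ᵐ x ∂leb01, ‖gaussTerm n (fun y => f (gaussMap y)) x‖ ≤
      1 / ((n + 1 : ℕ) : ℝ) ^ 2 * ‖f x‖ := by
  filter_upwards [ae_mem_Ico] with x hx
  rw [gaussTerm_comp_gaussMap n f hx, norm_smul, Real.norm_of_nonneg (by positivity)]
  gcongr
  exact le_add_of_nonneg_left hx.1

theorem integrableOn_comp_gaussMap (n : ℕ) {f : ℝ → E} (hf : Integrable f leb01) :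
    IntegrableOn (fun x => f (gaussMap x)) (branchIoc n) := by
  rw [← integrable_gaussTerm_iff]
  have hmeas : AEStronglyMeasurable (gaussTerm n fun x => f (gaussMap x)) leb01 := by
    have hweight : Measurable fun x : ℝ => 1 / (x + ((n + 1 : ℕ) : ℝ)) ^ 2 := by fun_prop
    refine (hweight.aestronglyMeasurable.smul hf.1).congr ?_
    filter_upwards [ae_mem_Ico] with x hx
    exact (gaussTerm_comp_gaussMap n f hx).symm
  exact (hf.norm.const_mul _).mono' hmeas (ae_norm_gaussTerm_comp_gaussMap_le n f)

theorem setIntegral_norm_comp_gaussMap_le (n : ℕ) {f : ℝ → E} (hf : Integrable f leb01) :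
    ∫ x in branchIoc n, ‖f (gaussMap x)‖ ≤ 1 / ((n + 1 : ℕ) : ℝ) ^ 2 * ∫ x, ‖f x‖ ∂leb01 := by
  rw [← integral_norm_gaussTerm n fun x => f (gaussMap x), ← integral_const_mul]
  exact integral_mono_ae
    ((integrable_gaussTerm_iff n _).2 (integrableOn_comp_gaussMap n hf)).norm
    (hf.norm.const_mul _) (ae_norm_gaussTerm_comp_gaussMap_le n f)

theorem hasSum_one_div_succ_sq :
    HasSum (fun n : ℕ => 1 / ((n + 1 : ℕ) : ℝ) ^ 2) (Real.pi ^ 2 / 6) := by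
  simpa using (hasSum_nat_add_iff' 1).2 hasSum_zeta_two

theorem integrable_comp_gaussMap {f : ℝ → E} (hf : Integrable f leb01) :
    Integrable (fun x => f (gaussMap x)) leb01 := by
  have hsum : Summable fun n => ∫ x in branchIoc n, ‖f (gaussMap x)‖ :=
    (hasSum_one_div_succ_sq.summable.mul_right _).of_nonneg_of_le
      (fun _ => integral_nonneg fun _ => norm_nonneg _)
      fun n => setIntegral_norm_comp_gaussMap_le n hf
  rw [leb01_eq_restrict_iUnion_branchIoc]
  exact integrableOn_iUnion_of_summable_integral_norm
    (fun n => integrableOn_comp_gaussMap n hf) hsum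

theorem integral_norm_comp_gaussMap_le {f : ℝ → E} (hf : Integrable f leb01) :
    ∫ x, ‖f (gaussMap x)‖ ∂leb01 ≤ Real.pi ^ 2 / 6 * ∫ x, ‖f x‖ ∂leb01 :=
  hasSum_le (fun n => setIntegral_norm_comp_gaussMap_le n hf)
    (hasSum_integral_branchIoc (integrable_comp_gaussMap hf).norm)
    (hasSum_one_div_succ_sq.mul_right _)

theorem one_lt_pi_sq_div_six : 1 < Real.pi ^ 2 / 6 := by
  nlinarith [Real.pi_gt_three]

end GaussTerm

section GaussL1

/-- The summand of the Gauss-Kuzmin-Wirsing operator, acting on `L¹`. -/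
def gaussTermL1 (n : ℕ) (f : ℝ →₁[leb01] ℂ) : ℝ →₁[leb01] ℂ :=
  (integrable_gaussTerm n (L1.integrable_coeFn f)).toL1 _

theorem coeFn_gaussTermL1 (n : ℕ) (f : ℝ →₁[leb01] ℂ) :
    gaussTermL1 n f =ᵐ[leb01] gaussTerm n f :=
  Integrable.coeFn_toL1 _

theorem gaussTermL1_add (n : ℕ) (f g : ℝ →₁[leb01] ℂ) :
    gaussTermL1 n (f + g) = gaussTermL1 n f + gaussTermL1 n g := by
  rw [gaussTermL1, gaussTermL1, gaussTermL1, ← Integrable.toL1_add, Integrable.toL1_eq_toL1_iff]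
  exact (gaussTerm_congr_ae n (Lp.coeFn_add f g)).trans
    (Eventually.of_forall fun _ => smul_add _ _ _)

theorem gaussTermL1_smul (n : ℕ) (a : ℂ) (f : ℝ →₁[leb01] ℂ) :
    gaussTermL1 n (a • f) = a • gaussTermL1 n f := by
  rw [gaussTermL1, gaussTermL1, ← Integrable.toL1_smul', Integrable.toL1_eq_toL1_iff]
  exact (gaussTerm_congr_ae n (Lp.coeFn_smul a f)).trans
    (Eventually.of_forall fun x => smul_comm _ a (f (branch n x)))

theorem hasSum_norm_gaussTermL1 (f : ℝ →₁[leb01] ℂ) :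
    HasSum (fun n => ‖gaussTermL1 n f‖) ‖f‖ := by
  simp only [gaussTermL1, L1.norm_of_fun_eq_integral_norm, integral_norm_gaussTerm,
    L1.norm_eq_integral_norm f]
  exact hasSum_integral_branchIoc (L1.integrable_coeFn f).norm

theorem summable_gaussTermL1 (f : ℝ →₁[leb01] ℂ) : Summable fun n => gaussTermL1 n f :=
  (hasSum_norm_gaussTermL1 f).summable.of_norm

/-- The Gauss-Kuzmin-Wirsing operator on `L¹([0,1])`. -/
def gaussL1 : (ℝ →₁[leb01] ℂ) →L[ℂ] (ℝ →₁[leb01] ℂ) :=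
  LinearMap.mkContinuous
    { toFun := fun f => ∑' n, gaussTermL1 n f
      map_add' := fun f g => by
        simp only [gaussTermL1_add]
        exact (summable_gaussTermL1 f).tsum_add (summable_gaussTermL1 g)
      map_smul' := fun a f => by
        simp only [gaussTermL1_smul]
        exact (summable_gaussTermL1 f).tsum_const_smul a } 1
    fun f => (tsum_of_norm_bounded (hasSum_norm_gaussTermL1 f) fun _ => le_rfl).trans_eq
      (one_mul _).symm

theorem hasSum_gaussL1 (f : ℝ →₁[leb01] ℂ) : HasSum (fun n => gaussTermL1 n f) (gaussL1 f) :=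
  (summable_gaussTermL1 f).hasSum

theorem integral_gaussL1 (f : ℝ →₁[leb01] ℂ) : ∫ x, gaussL1 f x ∂leb01 = ∫ x, f x ∂leb01 := by
  have h := (hasSum_gaussL1 f).mapL (L1.integralCLM (α := ℝ) (E := ℂ) (μ := leb01))
  simp only [← L1.integral_eq, L1.integral_eq_integral] at h
  refine h.unique ((hasSum_integral_branchIoc (L1.integrable_coeFn f)).congr_fun fun n => ?_)
  rw [integral_congr_ae (coeFn_gaussTermL1 n f), integral_gaussTerm]

theorem ae_hasSum_gaussTerm {f : ℝ → ℂ} (hf : Integrable f leb01) :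
    ∀ᵐ x ∂leb01, HasSum (fun n => gaussTerm n f x) (gaussL1 (hf.toL1 f) x) := by
  have hnorm : ∑' n, ‖gaussTermL1 n (hf.toL1 f)‖ₑ ≠ ⊤ :=
    tsum_enorm_ne_top_iff_summable_norm.2 (hasSum_norm_gaussTermL1 _).summable
  have hterm : ∀ᵐ x ∂leb01, ∀ n, gaussTermL1 n (hf.toL1 f) x = gaussTerm n f x :=
    ae_all_iff.2 fun n => (coeFn_gaussTermL1 n _).trans (gaussTerm_congr_ae n hf.coeFn_toL1)
  filter_upwards [Lp.hasSum_coeFn_tsum hnorm, hterm] with x hsum hx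
  simp only [hx] at hsum
  exact hsum

theorem ae_gaussL1_mul_comp (f g : ℝ → ℂ) (hf : Integrable f leb01)
    (hfg : Integrable (fun x => f x * g (gaussMap x)) leb01) :
    ∀ᵐ x ∂leb01,
      gaussL1 (hfg.toL1 fun x => f x * g (gaussMap x)) x = gaussL1 (hf.toL1 f) x * g x := by
  filter_upwards [ae_hasSum_gaussTerm hfg, ae_hasSum_gaussTerm hf, ae_mem_Ico] with x hfgx hfx hx
  refine hfgx.unique ((hfx.mul_right (g x)).congr_fun fun n => ?_)
  rw [gaussTerm, gaussTerm, gaussMap_branch n hx, smul_mul_assoc]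

theorem weight_one_zero (c : ℕ → ℝ) (n : ℕ) (z : ℂ) : weight c 1 0 n z = 1 / (z + n) ^ 2 := by
  rw [weight, zero_mul, Complex.exp_zero, mul_zero, add_zero, mul_one, Complex.cpow_ofNat]

theorem gaussTerm_eq_weight_mul (c : ℕ → ℝ) (n : ℕ) (f : ℝ → ℂ) (x : ℝ) :
    gaussTerm n f x = weight c 1 0 (n + 1) (x : ℂ) * f (1 / (x + ((n + 1 : ℕ) : ℝ))) := by
  rw [weight_one_zero, gaussTerm, Complex.real_smul, branch]
  push_cast
  rfl

theorem ae_hasSum_gaussL1 (c : ℕ → ℝ) (f : ℝ → ℂ) (hf : Integrable f leb01) :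
    ∀ᵐ (x : ℝ) ∂leb01,
      HasSum (fun n : ℕ => weight c 1 0 (n + 1) (x : ℂ) * f (1 / (x + ((n + 1 : ℕ) : ℝ))))
        (gaussL1 (hf.toL1 f) x) := by
  simpa only [gaussTerm_eq_weight_mul c] using ae_hasSum_gaussTerm hf

end GaussL1

/-! ### A maximum principle for averaging operators -/

section MaximumPrinciple

variable {E : Type*} [NormedAddCommGroup E] [InnerProductSpace ℝ E]

theorem eq_of_hasSum_smul_of_norm_le {ι : Type*} {p : ι → ℝ} {u : ι → E} {v : E}
    (hp : ∀ i, 0 < p i) (hp1 : HasSum p 1) (hu : ∀ i, ‖u i‖ ≤ ‖v‖)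
    (h : HasSum (fun i => p i • u i) v) (i : ι) : u i = v := by
  have hinner_le (i : ι) : inner ℝ v (u i) ≤ ‖v‖ ^ 2 :=
    (real_inner_le_norm v (u i)).trans <| by
      rw [sq]
      exact mul_le_mul_of_nonneg_left (hu i) (norm_nonneg v)
  have hsum_inner : HasSum (fun i => p i * inner ℝ v (u i)) (‖v‖ ^ 2) := by
    simpa only [innerSL_apply_apply, inner_smul_right, real_inner_self_eq_norm_sq]
      using h.mapL (innerSL ℝ v)
  have hsum_gap : HasSum (fun i => p i * (‖v‖ ^ 2 - inner ℝ v (u i))) 0 := by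
    have hsub := (hp1.mul_right (‖v‖ ^ 2)).sub hsum_inner
    rw [one_mul, sub_self] at hsub
    simpa only [mul_sub] using hsub
  have hgap : p i * (‖v‖ ^ 2 - inner ℝ v (u i)) = 0 :=
    congrFun ((hasSum_zero_iff_of_nonneg fun j =>
      mul_nonneg (hp j).le (sub_nonneg.2 (hinner_le j))).1 hsum_gap) i
  refine eq_of_norm_le_re_inner_eq_norm_sq (𝕜 := ℝ) (hu i) ?_
  rw [RCLike.re_to_real, real_inner_comm]
  exact (sub_eq_zero.1 ((mul_eq_zero.1 hgap).resolve_left (hp i).ne')).symm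

variable {𝕜 X : Type*} [NormedField 𝕜] [NormedSpace 𝕜 E] {s : Set X} {ψ : ℕ → X → X} {g : X → E}
  {k : 𝕜}

theorem eq_smul_of_isMaxOn_norm_of_hasSum {x : X} {q : ℕ → ℝ} (hψ : ∀ n, ψ n x ∈ s)
    (hq : ∀ n, 0 < q n) (hq1 : HasSum q 1) (hk : 1 ≤ ‖k‖)
    (h : HasSum (fun n => q n • g (ψ n x)) (k • g x)) (hmax : IsMaxOn (fun y => ‖g y‖) s x)
    (n : ℕ) : g (ψ n x) = k • g x := by
  refine eq_of_hasSum_smul_of_norm_le (u := fun n => g (ψ n x)) hq hq1 (fun m => ?_) h n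
  rw [norm_smul]
  exact (hmax (hψ m)).trans (le_mul_of_one_le_left (norm_nonneg _) hk)

/- Averaging against positive weights forces `g (ψ n x) = k • g x` at a maximum `x` of `‖g‖`.
Letting `n → ∞` moves the maximum to `x₀`, and then `k • g x₀ = g x₀`. -/
theorem apply_eq_of_hasSum_comp_eq_smul [TopologicalSpace X] {p : X → ℕ → ℝ} {x₀ : X}
    (hs : IsCompact s) (hψ : ∀ n, Set.MapsTo (ψ n) s s) (hx₀ : x₀ ∈ s)
    (hlim : ∀ x ∈ s, Tendsto (fun n => ψ n x) atTop (𝓝 x₀))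
    (hp : ∀ x ∈ s, ∀ n, 0 < p x n) (hp1 : ∀ x ∈ s, HasSum (p x) 1) (hg : ContinuousOn g s)
    (hk : 1 ≤ ‖k‖) (h : ∀ x ∈ s, HasSum (fun n => p x n • g (ψ n x)) (k • g x)) (n : ℕ) :
    g (ψ n x₀) = g x₀ := by
  have hbranch {x : X} (hx : x ∈ s) (hmax : IsMaxOn (fun y => ‖g y‖) s x) (n : ℕ) :
      g (ψ n x) = k • g x :=
    eq_smul_of_isMaxOn_norm_of_hasSum (fun m => hψ m hx) (hp x hx) (hp1 x hx) hk (h x hx) hmax n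
  have hlimit {x : X} (hx : x ∈ s) (hmax : IsMaxOn (fun y => ‖g y‖) s x) : g x₀ = k • g x := by
    have hmem : Tendsto (fun n => ψ n x) atTop (𝓝[s] x₀) :=
      tendsto_nhdsWithin_iff.2 ⟨hlim x hx, Eventually.of_forall fun m => hψ m hx⟩
    refine tendsto_nhds_unique ((hg x₀ hx₀).tendsto.comp hmem) ?_
    exact tendsto_const_nhds.congr fun m => (hbranch hx hmax m).symm
  obtain ⟨x₁, hx₁, hmax₁⟩ := hs.exists_isMaxOn ⟨x₀, hx₀⟩ hg.norm
  have hmax₀ : IsMaxOn (fun y => ‖g y‖) s x₀ := fun y hy => by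
    change ‖g y‖ ≤ ‖g x₀‖
    rw [hlimit hx₁ hmax₁, norm_smul]
    exact (hmax₁ hy).trans (le_mul_of_one_le_left (norm_nonneg _) hk)
  exact (hbranch hx₀ hmax₀ n).trans (hlimit hx₀ hmax₀).symm

end MaximumPrinciple

theorem eqOn_const_of_tendsto_of_forall_eq {𝕜 E : Type*} [NontriviallyNormedField 𝕜]
    [NormedAddCommGroup E] [NormedSpace 𝕜 E] {F : 𝕜 → E} {U : Set 𝕜} {z₀ : 𝕜} {u : ℕ → 𝕜} {a : E}
    (hF : AnalyticOnNhd 𝕜 F U) (hU : IsPreconnected U) (hz₀ : z₀ ∈ U)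
    (hu : Tendsto u atTop (𝓝 z₀)) (hne : ∀ n, u n ≠ z₀) (ha : ∀ n, F (u n) = a) :
    Set.EqOn F (fun _ => a) U := by
  have hu' : Tendsto u atTop (𝓝[≠] z₀) :=
    tendsto_nhdsWithin_iff.2 ⟨hu, Eventually.of_forall hne⟩
  exact hF.eqOn_of_preconnected_of_frequently_eq (fun _ _ => analyticAt_const) hU hz₀
    (hu'.frequently (Frequently.of_forall ha))

/-! ### The Gauss density and the dominant eigenvalue at `(1, 0)` -/

section DominantEigenvalue

theorem continuousOn_hval_ofReal (f : Hinf) :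
    ContinuousOn (fun x : ℝ => hval f (x : ℂ)) (Set.Icc 0 1) :=
  (continuousOn_hval f).comp Complex.continuous_ofReal.continuousOn fun _ hx => ofReal_mem_disc hx

theorem integrable_hval_ofReal (f : Hinf) : Integrable (fun x : ℝ => hval f (x : ℂ)) leb01 :=
  (continuousOn_hval_ofReal f).integrableOn_Icc

theorem intervalIntegral_eq_integral_leb01 {E : Type*} [NormedAddCommGroup E] [NormedSpace ℝ E]
    (g : ℝ → E) : ∫ x in (0 : ℝ)..1, g x = ∫ x, g x ∂leb01 := by
  rw [leb01_eq_restrict_Ioc, intervalIntegral.integral_of_le zero_le_one]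

/-- Integration over `[0, 1]`, as a bounded functional on `Hinf`. -/
def intFun : Hinf →L[ℂ] ℂ :=
  LinearMap.mkContinuous
    { toFun := fun f => ∫ x in (0 : ℝ)..1, hval f (x : ℂ)
      map_add' := fun f g => by
        simp only [hval_add, intervalIntegral_eq_integral_leb01]
        exact integral_add (integrable_hval_ofReal f) (integrable_hval_ofReal g)
      map_smul' := fun a f => by
        simp only [hval_smul]
        exact intervalIntegral.integral_const_mul a _ } 1
    fun f => by
      refine (intervalIntegral.norm_integral_le_of_norm_le_const
        fun x _ => norm_hval_le f (x : ℂ)).trans_eq ?_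
      rw [sub_zero, abs_one, mul_one, one_mul]

theorem intFun_apply (f : Hinf) : intFun f = ∫ x in (0 : ℝ)..1, hval f (x : ℂ) := rfl

theorem one_add_ne_zero_of_mem_disc {z : ℂ} (hz : z ∈ disc) : 1 + z ≠ 0 := by
  have h := add_natCast_succ_ne_zero hz 0
  rwa [zero_add, Nat.cast_one, add_comm] at h

theorem ofReal_log_two_ne_zero : (Real.log 2 : ℂ) ≠ 0 :=
  Complex.ofReal_ne_zero.2 (Real.log_pos one_lt_two).ne'

theorem differentiableOn_xi : DifferentiableOn ℂ xi disc := fun z hz => by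
  have h : (Real.log 2 : ℂ) * (1 + z) ≠ 0 :=
    mul_ne_zero ofReal_log_two_ne_zero (one_add_ne_zero_of_mem_disc hz)
  unfold xi
  exact DifferentiableAt.differentiableWithinAt (by fun_prop (disch := assumption))

theorem norm_xi_le {z : ℂ} (hz : z ∈ disc) : ‖xi z‖ ≤ 1 / (Real.log 2 * (2 / 3)) := by
  have hlog : 0 < Real.log 2 := Real.log_pos one_lt_two
  have hre := two_thirds_le_re_add (disc_subset_closedBall hz) 0
  rw [zero_add, Nat.cast_one, add_comm] at hre
  rw [xi, norm_div, norm_one, norm_mul, Complex.norm_real, Real.norm_of_nonneg hlog.le]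
  exact one_div_le_one_div_of_le (by positivity)
    (mul_le_mul_of_nonneg_left (hre.trans (Complex.re_le_norm _)) hlog.le)

/-- The Gauss density as an element of `Hinf`. -/
def xiH : Hinf := ofBounded xi differentiableOn_xi ⟨_, fun _ hz => norm_xi_le hz⟩

theorem hval_xiH {z : ℂ} (hz : z ∈ disc) : hval xiH z = xi z := hval_ofBounded hz

theorem one_add_mul_hval_xiH {z : ℂ} (hz : z ∈ disc) :
    (1 + z) * hval xiH z = (Real.log 2 : ℂ)⁻¹ := by
  have hz1 := one_add_ne_zero_of_mem_disc hz
  have hlog := ofReal_log_two_ne_zero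
  rw [hval_xiH hz, xi]
  field_simp

theorem intFun_xiH : intFun xiH = 1 := by
  have hval_eq : ∀ x ∈ Set.uIcc (0 : ℝ) 1,
      hval xiH (x : ℂ) = (((Real.log 2)⁻¹ * (1 + x)⁻¹ : ℝ) : ℂ) := fun x hx => by
    rw [Set.uIcc_of_le zero_le_one] at hx
    rw [hval_xiH (ofReal_mem_disc hx), xi, one_div, mul_inv]
    push_cast
    rfl
  rw [intFun_apply, intervalIntegral.integral_congr hval_eq, intervalIntegral.integral_ofReal,
    intervalIntegral.integral_const_mul,
    intervalIntegral.integral_comp_add_left (fun y : ℝ => y⁻¹) 1,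
    integral_inv_of_pos (by norm_num) (by norm_num)]
  norm_num

theorem tendsto_one_div_add_natCast {𝕜 : Type*} [RCLike 𝕜] (z : 𝕜) :
    Tendsto (fun n : ℕ => 1 / (z + n)) atTop (𝓝 0) := by
  simp only [one_div]
  exact tendsto_inv₀_cobounded.comp
    ((tendsto_const_add_cobounded z).comp tendsto_natCast_atTop_cobounded)

theorem one_div_add_mem_disc {z : ℂ} (hz : z ∈ disc) (n : ℕ) : 1 / (z + (n + 1 : ℕ)) ∈ disc :=
  closedBall_subset_disc (mapsTo_one_div_add n hz)

theorem weight_one_zero_mul_hval_xiH (c : ℕ → ℝ) {z : ℂ} (hz : z ∈ disc) (n : ℕ) :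
    weight c 1 0 (n + 1) z * hval xiH (1 / (z + ((n + 1 : ℕ) : ℂ))) =
      (Real.log 2 : ℂ)⁻¹ * (1 / (z + 1 + n) - 1 / (z + 1 + ((n + 1 : ℕ) : ℂ))) := by
  have hn := add_natCast_succ_ne_zero hz n
  have hn1 := add_natCast_succ_ne_zero hz (n + 1)
  have hlog := ofReal_log_two_ne_zero
  have hone : 1 + 1 / (z + ((n + 1 : ℕ) : ℂ)) = (z + (n + 1 + 1 : ℕ)) / (z + (n + 1 : ℕ)) := by
    field_simp
    push_cast
    ring
  rw [weight_one_zero, hval_xiH (one_div_add_mem_disc hz n), xi, hone, add_assoc z 1,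
    add_assoc z 1, add_comm (1 : ℂ) n, add_comm (1 : ℂ) (n + 1 : ℕ), ← Nat.cast_succ,
    ← Nat.cast_succ, Nat.succ_eq_add_one, Nat.succ_eq_add_one]
  field_simp
  push_cast
  ring

section TransferOperator

variable {c : ℕ → ℝ} {L : Hinf →L[ℂ] Hinf}

theorem map_xiH (hL : IsTransferOp c 1 1 0 L) : L xiH = xiH := by
  refine Hinf.ext_hval fun z hz => tendsto_nhds_unique (hL xiH z hz).tendsto_sum_nat ?_
  have hlimit : hval xiH z = (Real.log 2 : ℂ)⁻¹ * (1 / (z + 1 + (0 : ℕ)) - 0) := by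
    rw [hval_xiH hz, xi, sub_zero, one_div, one_div, mul_inv, Nat.cast_zero, add_zero, add_comm 1 z]
  simp only [weight_one_zero_mul_hval_xiH c hz, ← Finset.mul_sum,
    Finset.sum_range_sub' (fun n : ℕ => 1 / (z + 1 + (n : ℂ))), hlimit]
  exact (tendsto_const_nhds.sub (tendsto_one_div_add_natCast (z + 1))).const_mul _

theorem intFun_map (hL : IsTransferOp c 1 1 0 L) (f : Hinf) : intFun (L f) = intFun f := by
  have hf := integrable_hval_ofReal f
  have hLf : (fun x : ℝ => hval (L f) (x : ℂ)) =ᵐ[leb01]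
      gaussL1 (hf.toL1 fun x : ℝ => hval f (x : ℂ)) := by
    filter_upwards [ae_hasSum_gaussL1 c _ hf, ae_mem_Ico] with x hsum hx
    refine (hL f x (ofReal_mem_disc (Set.Ico_subset_Icc_self hx))).unique
      (hsum.congr_fun fun n => ?_)
    push_cast
    rfl
  rw [intFun_apply, intFun_apply, intervalIntegral_eq_integral_leb01,
    intervalIntegral_eq_integral_leb01, integral_congr_ae hLf, integral_gaussL1]
  exact integral_congr_ae hf.coeFn_toL1

/-- The transition weights of the operator `f ↦ ξ⁻¹ L (ξ f)`, where `L` is the transfer operator at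
`(1, 0)`: it averages `f` over the preimages of a point under the Gauss map. -/
def transWeight (x : ℝ) (n : ℕ) : ℝ := (1 + x) / ((x + n + 1) * (x + n + 2))

theorem transWeight_pos {x : ℝ} (hx : 0 ≤ x) (n : ℕ) : 0 < transWeight x n := by
  unfold transWeight
  positivity

theorem one_add_mul_weight_one_zero (c : ℕ → ℝ) {x : ℝ} (hx : 0 ≤ x) (n : ℕ) :
    (1 + (x : ℂ)) * weight c 1 0 (n + 1) x = transWeight x n * (1 + (branch n x : ℂ)) := by
  have hn : x + n + 1 ≠ 0 := by positivity
  have hn1 : x + n + 2 ≠ 0 := by positivity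
  have hreal : (1 + x) * (1 / (x + (n + 1)) ^ 2) = transWeight x n * (1 + branch n x) := by
    rw [transWeight, branch, Nat.cast_succ, ← add_assoc]
    field_simp
    ring
  rw [weight_one_zero]
  exact_mod_cast congrArg Complex.ofReal hreal

theorem ofReal_branch (n : ℕ) (x : ℝ) :
    (branch n x : ℂ) = 1 / ((x : ℂ) + ((n + 1 : ℕ) : ℂ)) := by
  rw [branch]
  push_cast
  rfl

theorem mapsTo_branch_Icc (n : ℕ) : Set.MapsTo (branch n) (Set.Icc 0 1) (Set.Icc 0 1) :=
  fun x hx => by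
    have hx0 := hx.1
    have hden : 1 ≤ x + ((n + 1 : ℕ) : ℝ) :=
      (Nat.one_le_cast.2 (Nat.le_add_left 1 n)).trans (le_add_of_nonneg_left hx0)
    exact ⟨one_div_nonneg.2 (zero_le_one.trans hden), div_le_one_of_le₀ hden (by positivity)⟩

theorem tendsto_branch (x : ℝ) : Tendsto (fun n => branch n x) atTop (𝓝 0) :=
  (tendsto_one_div_add_natCast x).comp (tendsto_add_atTop_nat 1)

theorem hasSum_transWeight_smul (hL : IsTransferOp c 1 1 0 L) (f : Hinf) {x : ℝ}
    (hx : x ∈ Set.Icc (0 : ℝ) 1) :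
    HasSum (fun n => transWeight x n • ((1 + (branch n x : ℂ)) * hval f (branch n x)))
      ((1 + (x : ℂ)) * hval (L f) x) := by
  refine ((hL f x (ofReal_mem_disc hx)).mul_left (1 + (x : ℂ))).congr_fun fun n => ?_
  rw [← mul_assoc, one_add_mul_weight_one_zero c hx.1, ofReal_branch, mul_assoc, Complex.real_smul]

theorem hasSum_transWeight (hL : IsTransferOp c 1 1 0 L) {x : ℝ} (hx : x ∈ Set.Icc (0 : ℝ) 1) :
    HasSum (transWeight x) 1 := by
  have hlog : Real.log 2 ≠ 0 := (Real.log_pos one_lt_two).ne'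
  have hxi (y : ℝ) (hy : y ∈ Set.Icc (0 : ℝ) 1) :
      (1 + (y : ℂ)) * hval xiH y = ((Real.log 2)⁻¹ : ℝ) := by
    rw [one_add_mul_hval_xiH (ofReal_mem_disc hy), Complex.ofReal_inv]
  have hsum := hasSum_transWeight_smul hL xiH hx
  simp only [map_xiH hL, hxi x hx, fun n => hxi _ (mapsTo_branch_Icc n hx), Complex.real_smul,
    ← Complex.ofReal_mul] at hsum
  have hreal := (Complex.hasSum_ofReal.1 hsum).mul_right (Real.log 2)
  simpa only [mul_assoc, inv_mul_cancel₀ hlog, mul_one] using hreal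

theorem one_add_mul_hval_eq_of_map_eq_smul (hL : IsTransferOp c 1 1 0 L) {f : Hinf} {k : ℂ}
    (hk : 1 ≤ ‖k‖) (hf : L f = k • f) : Set.EqOn (fun z => (1 + z) * hval f z)
      (fun _ => hval f 0) disc := by
  have hzero : (0 : ℝ) ∈ Set.Icc (0 : ℝ) 1 := Set.left_mem_Icc.2 zero_le_one
  have hbranch (n : ℕ) : (1 + (branch n 0 : ℂ)) * hval f (branch n 0) = hval f 0 := by
    have h := apply_eq_of_hasSum_comp_eq_smul (k := k) isCompact_Icc mapsTo_branch_Icc hzero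
      (fun x _ => tendsto_branch x) (fun x hx => transWeight_pos hx.1)
      (fun x hx => hasSum_transWeight hL hx)
      ((Complex.continuous_ofReal.const_add 1).continuousOn.mul (continuousOn_hval_ofReal f)) hk
      (fun x hx => by
        have hsum := hasSum_transWeight_smul hL f hx
        rw [hf, hval_smul, Pi.smul_apply, mul_smul_comm] at hsum
        exact hsum) n
    simp only [Pi.mul_apply, Complex.ofReal_zero, add_zero, one_mul] at h
    exact h
  refine eqOn_const_of_tendsto_of_forall_eq (u := fun n => (branch n 0 : ℂ))
    (fun z hz => (analyticAt_const.add analyticAt_id).mul (analyticAt_hval f hz))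
    (convex_ball _ _).isPreconnected (ofReal_mem_disc hzero)
    ((Complex.continuous_ofReal.tendsto 0).comp (tendsto_branch 0)) (fun n => ?_) hbranch
  refine Complex.ofReal_injective.ne (ne_of_gt ?_)
  unfold branch
  positivity

theorem eq_smul_xiH_of_map_eq_smul (hL : IsTransferOp c 1 1 0 L) {f : Hinf} {k : ℂ}
    (hk : 1 ≤ ‖k‖) (hf : L f = k • f) : f = (hval f 0 * Real.log 2) • xiH := by
  refine Hinf.ext_hval fun z hz => mul_left_cancel₀ (one_add_ne_zero_of_mem_disc hz) ?_
  rw [hval_smul, Pi.smul_apply, mul_smul_comm, one_add_mul_hval_xiH hz, smul_eq_mul,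
    mul_inv_cancel_right₀ ofReal_log_two_ne_zero]
  exact one_add_mul_hval_eq_of_map_eq_smul hL hk hf hz

theorem eq_zero_of_map_eq_smul (hL : IsTransferOp c 1 1 0 L) {f : Hinf} {k : ℂ} (hk : 1 ≤ ‖k‖)
    (hf : L f = k • f) (hint : intFun f = 0) : f = 0 := by
  have hmul := eq_smul_xiH_of_map_eq_smul hL hk hf
  rw [hmul, map_smul, intFun_xiH, smul_eq_mul, mul_one] at hint
  rw [hmul, hint, zero_smul]

theorem spectralRadius_sub_smulRight_xiH_lt_one (hL : IsTransferOp c 1 1 0 L)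
    (hLc : IsCompactOperator L) : spectralRadius ℂ (L - intFun.smulRight xiH) < 1 :=
  spectralRadius_sub_smulRight_lt_one hLc intFun_xiH (intFun_map hL)
    fun _ hk _ hf hint => eq_zero_of_map_eq_smul hL hk hf hint

end TransferOperator

end DominantEigenvalue

/-! ### The perturbed transfer operator near `(1, 0)` -/

theorem exists_isRankOneSplitting_opL {c : ℕ → ℝ} (hc : ∃ M : ℝ, ∀ n, 1 ≤ n → |c n| ≤ M) :
    ∃ V, IsOpen V ∧ ((1 : ℂ), (0 : ℂ)) ∈ V ∧ V ⊆ convergenceDomain c ∧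
      ∃ (lam : ℂ × ℂ → ℂ) (P N : ℂ × ℂ → (Hinf →L[ℂ] Hinf)),
        AnalyticOnNhd ℂ lam V ∧ AnalyticOnNhd ℂ P V ∧ AnalyticOnNhd ℂ N V ∧
        (∀ p ∈ V, IsRankOneSplitting (opL c p) (lam p) (P p) (N p) ∧
          spectralRadius ℂ (N p) < 1 ∧ spectralRadius ℂ (N p) < ‖lam p‖ₑ) ∧
        lam (1, 0) = 1 ∧ P (1, 0) = intFun.smulRight xiH := by
  have hmem : ((1 : ℂ), (0 : ℂ)) ∈ convergenceDomain c :=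
    mk_zero_mem_convergenceDomain c (by norm_num)
  have hL : IsTransferOp c 1 1 0 (opL c (1, 0)) := isTransferOp_transferOp hc 0 hmem
  have hLc : IsCompactOperator (opL c (1, 0)) := isCompactOperator_transferOp hc 0 hmem
  exact exists_analyticOnNhd_isRankOneSplitting ((isOpen_convergenceDomain c).mem_nhds hmem)
    (analyticOnNhd_transferOp hc 0 _ hmem) intFun_xiH (map_xiH hL) (intFun_map hL)
    (spectralRadius_sub_smulRight_xiH_lt_one hL hLc)

end

end GaussEuclid

theorem mainTheorem2_general (c : ℕ → ℝ) (hc : ∃ M : ℝ, ∀ n, 1 ≤ n → |c n| ≤ M) :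
    (∃ U : Set (ℂ × ℂ), IsOpen U ∧ (∀ p ∈ U, 1 / 2 < p.1.re) ∧
      (∀ s : ℂ, 1 / 2 < s.re → (s, (0 : ℂ)) ∈ U) ∧
      (∀ p ∈ U, IsTransferOp c 1 p.1 p.2 (opL c p) ∧ IsTransferOp c 2 p.1 p.2 (opF c p) ∧
        IsCompactOperator (opL c p) ∧ IsCompactOperator (opF c p)) ∧
      AnalyticOnNhd ℂ (opL c) U ∧ AnalyticOnNhd ℂ (opF c) U ∧
      ∃ V : Set (ℂ × ℂ), IsOpen V ∧ ((1 : ℂ), (0 : ℂ)) ∈ V ∧ V ⊆ U ∧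
        ∃ (lam : ℂ × ℂ → ℂ) (P N : ℂ × ℂ → (Hinf →L[ℂ] Hinf)),
          AnalyticOnNhd ℂ lam V ∧ AnalyticOnNhd ℂ P V ∧ AnalyticOnNhd ℂ N V ∧
          (∀ p ∈ V,
            opL c p = lam p • P p + N p ∧
            (P p).comp (N p) = 0 ∧ (N p).comp (P p) = 0 ∧
            (P p).comp (P p) = P p ∧
            Module.finrank ℂ (LinearMap.range (P p : Hinf →ₗ[ℂ] Hinf)) = 1 ∧
            LinearMap.range (P p : Hinf →ₗ[ℂ] Hinf) =
              Module.End.eigenspace (opL c p : Hinf →ₗ[ℂ] Hinf) (lam p) ∧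
            spectralRadius ℂ (N p) < 1 ∧
            spectralRadius ℂ (N p) < ‖lam p‖ₑ) ∧
          lam (1, 0) = 1 ∧
          ∀ (f : Hinf), ∀ z ∈ disc,
            hval (P (1, 0) f) z = (∫ x in (0 : ℝ)..1, hval f (x : ℂ)) * xi z) ∧
    (∃ A : (ℝ →₁[leb01] ℂ) →L[ℂ] (ℝ →₁[leb01] ℂ),
      (∀ (f : ℝ → ℂ) (hf : Integrable f leb01), ∀ᵐ (x : ℝ) ∂leb01,
        HasSum (fun n : ℕ => weight c 1 0 (n + 1) (x : ℂ) * f (1 / (x + ((n + 1 : ℕ) : ℝ))))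
          (A (hf.toL1 f) x)) ∧
      (∀ f : ℝ →₁[leb01] ℂ, ∫ x, A f x ∂leb01 = ∫ x, f x ∂leb01) ∧
      (∀ (f g : ℝ → ℂ) (hf : Integrable f leb01)
        (hfg : Integrable (fun x => f x * g (gaussMap x)) leb01),
        ∀ᵐ (x : ℝ) ∂leb01,
          A (hfg.toL1 fun x => f x * g (gaussMap x)) x = A (hf.toL1 f) x * g x)) ∧
    (∃ C : ℝ, 1 < C ∧ ∀ f : ℝ → ℂ, Integrable f leb01 →
      Integrable (fun x => f (gaussMap x)) leb01 ∧
      ∫ x, ‖f (gaussMap x)‖ ∂leb01 ≤ C * ∫ x, ‖f x‖ ∂leb01) := by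
  refine ⟨?_, ⟨gaussL1, ae_hasSum_gaussL1 c, integral_gaussL1, ae_gaussL1_mul_comp⟩,
    ⟨Real.pi ^ 2 / 6, one_lt_pi_sq_div_six,
      fun f hf => ⟨integrable_comp_gaussMap hf, integral_norm_comp_gaussMap_le hf⟩⟩⟩
  obtain ⟨V, hVo, hVmem, hVsub, lam, P, N, hlam, hP, hN, hV, hlam1, hP1⟩ :=
    exists_isRankOneSplitting_opL hc
  refine ⟨convergenceDomain c, isOpen_convergenceDomain c, fun p hp => hp.1,
    fun s hs => mk_zero_mem_convergenceDomain c hs, fun p hp =>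
      ⟨isTransferOp_transferOp hc 0 hp, isTransferOp_transferOp hc 1 hp,
        isCompactOperator_transferOp hc 0 hp, isCompactOperator_transferOp hc 1 hp⟩,
    analyticOnNhd_transferOp hc 0, analyticOnNhd_transferOp hc 1,
    V, hVo, hVmem, hVsub, lam, P, N, hlam, hP, hN, fun p hp => ?_, hlam1, fun f z hz => ?_⟩
  · obtain ⟨⟨hadd, hPN, hNP, hPP, hrank, hrange⟩, hradius⟩ := hV p hp
    exact ⟨hadd, hPN, hNP, hPP, hrank, hrange, hradius⟩
  · rw [hP1, ContinuousLinearMap.smulRight_apply, hval_smul, Pi.smul_apply, hval_xiH hz,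
      intFun_apply, smul_eq_mul]

theorem mainTheorem2 (c : ℕ → ℝ) (hc_nonneg : ∀ n, 1 ≤ n → 0 ≤ c n)
    (hc_bdd : ∃ M : ℝ, ∀ n, 1 ≤ n → c n ≤ M) :
    -- (i) on an open set `U` of pairs `(s, ω)` that contains `(s, 0)` whenever `Re s > 1/2`
    (∃ U : Set (ℂ × ℂ), IsOpen U ∧ (∀ p ∈ U, 1 / 2 < p.1.re) ∧
      (∀ s : ℂ, 1 / 2 < s.re → (s, (0 : ℂ)) ∈ U) ∧
      (∀ p ∈ U, IsTransferOp c 1 p.1 p.2 (opL c p) ∧ IsTransferOp c 2 p.1 p.2 (opF c p) ∧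
        IsCompactOperator (opL c p) ∧ IsCompactOperator (opF c p)) ∧
      AnalyticOnNhd ℂ (opL c) U ∧ AnalyticOnNhd ℂ (opF c) U ∧
      -- (iii) the spectral splitting near `(1, 0)`
      ∃ V : Set (ℂ × ℂ), IsOpen V ∧ ((1 : ℂ), (0 : ℂ)) ∈ V ∧ V ⊆ U ∧
        ∃ (lam : ℂ × ℂ → ℂ) (P N : ℂ × ℂ → (Hinf →L[ℂ] Hinf)),
          AnalyticOnNhd ℂ lam V ∧ AnalyticOnNhd ℂ P V ∧ AnalyticOnNhd ℂ N V ∧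
          (∀ p ∈ V,
            opL c p = lam p • P p + N p ∧
            (P p).comp (N p) = 0 ∧ (N p).comp (P p) = 0 ∧
            (P p).comp (P p) = P p ∧
            Module.finrank ℂ (LinearMap.range (P p : Hinf →ₗ[ℂ] Hinf)) = 1 ∧
            LinearMap.range (P p : Hinf →ₗ[ℂ] Hinf) =
              Module.End.eigenspace (opL c p : Hinf →ₗ[ℂ] Hinf) (lam p) ∧
            spectralRadius ℂ (N p) < 1 ∧
            spectralRadius ℂ (N p) < ‖lam p‖ₑ) ∧
          lam (1, 0) = 1 ∧
          ∀ (f : Hinf), ∀ z ∈ disc,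
            hval (P (1, 0) f) z = (∫ x in (0 : ℝ)..1, hval f (x : ℂ)) * xi z) ∧
    -- (ii) the action of `𝓛_{1,0}` on `L¹([0,1])`
    (∃ A : (ℝ →₁[leb01] ℂ) →L[ℂ] (ℝ →₁[leb01] ℂ),
      (∀ (f : ℝ → ℂ) (hf : Integrable f leb01), ∀ᵐ (x : ℝ) ∂leb01,
        HasSum (fun n : ℕ => weight c 1 0 (n + 1) (x : ℂ) * f (1 / (x + ((n + 1 : ℕ) : ℝ))))
          (A (hf.toL1 f) x)) ∧
      (∀ f : ℝ →₁[leb01] ℂ, ∫ x, A f x ∂leb01 = ∫ x, f x ∂leb01) ∧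
      (∀ (f g : ℝ → ℂ) (hf : Integrable f leb01)
        (hfg : Integrable (fun x => f x * g (gaussMap x)) leb01),
        ∀ᵐ (x : ℝ) ∂leb01,
          A (hfg.toL1 fun x => f x * g (gaussMap x)) x = A (hf.toL1 f) x * g x)) ∧
    (∃ C : ℝ, 1 < C ∧ ∀ f : ℝ → ℂ, Integrable f leb01 →
      Integrable (fun x => f (gaussMap x)) leb01 ∧
      ∫ x, ‖f (gaussMap x)‖ ∂leb01 ≤ C * ∫ x, ‖f x‖ ∂leb01) := by
  exact mainTheorem2_general c <| hc_bdd.imp fun M hM n hn =>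
    (abs_of_nonneg (hc_nonneg n hn)).trans_le (hM n hn)
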